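/- For $k\in[0,1)$ let $\mathbf K(k)=\int_0^{\pi/2}\frac{d\theta}{\sqrt{1-k^2\sin^2\theta}}$ denote the complete elliptic integral of the first kind with modulus $k$. Then the function $x\mapsto \mathbf K\big(2\sqrt{x(1-x)}\big)\big/\sqrt{3+4i(1-2x)}$ (defined for $x\in[0,1]$, $x\neq\tfrac12$, with the principal branch of the complex square root in the denominator) is integrable on $[0,1]$, and \[ \int_0^1\frac{\mathbf K\big(2\sqrt{x(1-x)}\big)}{\sqrt{3+4i(1-2x)}}\,dx=\frac{\sqrt3\,\big[\Gamma\big(\tfrac13\big)\big]^6}{2^{17/3}\,\pi^2}. \] -/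

import Mathlib

/-- The complete elliptic integral of the first kind with real modulus `k`,
`K(k) = ∫_0^{π/2} dθ / √(1 - k² sin² θ)`.  The integral converges for `|k| < 1`. -/
noncomputable def ellipticK (k : ℝ) : ℝ :=
  ∫ θ in (0 : ℝ)..(Real.pi / 2), 1 / Real.sqrt (1 - k ^ 2 * Real.sin θ ^ 2)

/-! ### Coefficient identities for hypergeometric series and Legendre moments. -/

section Coefficients

open Finset

/-! With `u = 1 - 2x` the integral becomes `(1/2) ∫_{-1}^{1} K(√(1-u²)) / √(3+4iu) du`. Three facts
evaluate it.

The measure `K(√(1-u²)) du` on `(0,1)` is the image of Lebesgue measure on `(0,π/2)²` under `(γ,φ) ↦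
sin γ sin φ` (`withDensity_ellipticK_complementary`), so its even moments are squares of Wallis
integrals.

Since `3+4iu = 4(1-2tu+t²)` for `t = -i/2`, the other factor is half the Legendre generating
function at `t`. Adding the contributions of `u` and `-u` removes the odd Legendre polynomials, and
the average of `P_{2m}` is `(π²/4)(-1)^m ((1/2)_m/m!)³` (`sum_antidiagonal_legendre_moment`). As
`-t² = 1/4`, what remains is the series `∑ ((1/2)_m/m!)³ 4^{-m}`.

Clausen's formula writes this series as `₂F₁(1/4,1/4;1;1/4)²`, and the quadratic transformation at
the root `x = k₃²` of `4x(1-x) = 1/4` turns it into `(2K(k₃)/π)²` (`tsum_pochRatio_half_cube`). The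
integral is therefore `K(k₃)²/2`. Finally `K(k₃)` is a multiple of `B(1/6,1/2)`, which duplication
and reflection reduce to `Γ(1/3)` (`ellipticK_singularModulusThree_sq_div_two`). -/

/-- The ratio `(α)ₙ / n!` of a Pochhammer symbol by a factorial. -/
noncomputable def pochRatio (α : ℝ) (n : ℕ) : ℝ := ∏ i ∈ range n, (α + i) / (i + 1)

@[simp] lemma pochRatio_zero (α : ℝ) : pochRatio α 0 = 1 := by simp [pochRatio]

lemma succ_mul_pochRatio_succ (α : ℝ) (n : ℕ) :
    ((n : ℝ) + 1) * pochRatio α (n + 1) = (α + n) * pochRatio α n := by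
  rw [pochRatio, prod_range_succ, ← pochRatio]
  field_simp

lemma pochRatio_nonneg {α : ℝ} (h : 0 ≤ α) (n : ℕ) : 0 ≤ pochRatio α n :=
  prod_nonneg fun i _ => by positivity

lemma pochRatio_le_one {α : ℝ} (h0 : 0 ≤ α) (h1 : α ≤ 1) (n : ℕ) : pochRatio α n ≤ 1 :=
  prod_le_one (fun i _ => by positivity) fun i _ => by
    rw [div_le_one (by positivity)]; linarith

lemma sum_antidiagonal_succ_fst_mul (n : ℕ) (f : ℕ → ℕ → ℝ) :
    ∑ p ∈ antidiagonal (n + 1), (p.1 : ℝ) * f p.1 p.2 =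
      ∑ p ∈ antidiagonal n, ((p.1 : ℝ) + 1) * f (p.1 + 1) p.2 := by
  rw [Nat.sum_antidiagonal_succ]; simp

lemma sum_antidiagonal_succ_snd_mul (n : ℕ) (f : ℕ → ℕ → ℝ) :
    ∑ p ∈ antidiagonal (n + 1), (p.2 : ℝ) * f p.1 p.2 =
      ∑ p ∈ antidiagonal n, ((p.2 : ℝ) + 1) * f p.1 (p.2 + 1) := by
  rw [Nat.sum_antidiagonal_succ']; simp

lemma cast_add_of_mem_antidiagonal {n : ℕ} {p : ℕ × ℕ} (hp : p ∈ antidiagonal n) :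
    (p.1 : ℝ) + p.2 = n := by
  exact_mod_cast mem_antidiagonal.1 hp

/-- The coefficients of **Clausen's formula** `₂F₁(1/4,1/4;1;x)² = ₃F₂(1/2,1/2,1/2;1,1;x)`. -/
theorem sum_antidiagonal_pochRatio_quarter_sq (n : ℕ) :
    ∑ p ∈ antidiagonal n, pochRatio (1 / 4) p.1 ^ 2 * pochRatio (1 / 4) p.2 ^ 2 =
      pochRatio (1 / 2) n ^ 3 := by
  induction n with
  | zero => simp
  | succ n ih =>
    have hn : ((n : ℝ) + 1) ^ 3 ≠ 0 := by positivity
    apply mul_left_cancel₀ hn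
    set a : ℕ → ℝ := fun i => pochRatio (1 / 4) i ^ 2 with ha
    have rec_a : ∀ i : ℕ, ((i : ℝ) + 1) ^ 2 * a (i + 1) = (1 / 4 + i) ^ 2 * a i := by
      intro i
      simp only [ha]
      rw [← mul_pow, succ_mul_pochRatio_succ, mul_pow]
    -- For `i+j = n+1`, split `(i+j)³ = i²(i+3j) + j²(j+3i)`. The factors `i²` and `j²` are what the
    -- recurrence of `a` absorbs after an index shift, and the shifted weights recombine termwise to
    -- `(i+j+1/2)³`.
    have e1 := sum_antidiagonal_succ_fst_mul n
      fun i j => (i : ℝ) * ((i : ℝ) + 3 * j) * (a i * a j)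
    have e2 := sum_antidiagonal_succ_snd_mul n
      fun i j => (j : ℝ) * ((j : ℝ) + 3 * i) * (a i * a j)
    have e3 : ((n : ℝ) + 1) ^ 3 * ∑ p ∈ antidiagonal (n + 1), a p.1 * a p.2 =
        ∑ p ∈ antidiagonal (n + 1), ((p.1 : ℝ) * (p.1 * (p.1 + 3 * p.2) * (a p.1 * a p.2))) +
        ∑ p ∈ antidiagonal (n + 1), ((p.2 : ℝ) * (p.2 * (p.2 + 3 * p.1) * (a p.1 * a p.2))) := by
      rw [← sum_add_distrib, mul_sum]
      refine sum_congr rfl fun p hp => ?_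
      have h := cast_add_of_mem_antidiagonal hp
      push_cast at h
      rw [← h]; ring
    have e4 : (((n : ℝ) + 1) * pochRatio (1 / 2) (n + 1)) ^ 3 =
        ∑ p ∈ antidiagonal n, (1 / 2 + (n : ℝ)) ^ 3 * (a p.1 * a p.2) := by
      rw [succ_mul_pochRatio_succ, mul_pow, ← ih, mul_sum]
    rw [← mul_pow, e4]
    refine e3.trans ?_
    rw [e1, e2, ← sum_add_distrib]
    refine sum_congr rfl fun p hp => ?_
    have h := cast_add_of_mem_antidiagonal hp
    rw [← h]
    push_cast
    linear_combination ((p.1 : ℝ) + 1 + 3 * p.2) * a p.2 * rec_a p.1 +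
      ((p.2 : ℝ) + 1 + 3 * p.1) * a p.1 * rec_a p.2

lemma cast_succ_mul_choose_succ (n j : ℕ) :
    ((j : ℝ) + 1) * (n.choose (j + 1) : ℝ) = ((n : ℝ) - j) * n.choose j := by
  rcases le_or_gt j n with h | h
  · have := Nat.choose_succ_right_eq n j
    have h2 : ((n.choose (j + 1) * (j + 1) : ℕ) : ℝ) = ((n.choose j * (n - j) : ℕ) : ℝ) := by
      rw [this]
    push_cast [Nat.cast_sub h] at h2
    linarith
  · simp [Nat.choose_eq_zero_of_lt h, Nat.choose_eq_zero_of_lt (h.trans (Nat.lt_succ_self j))]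

lemma cast_succ_sub_mul_choose (n j : ℕ) :
    ((n : ℝ) + 1 - j) * ((n + 1).choose j : ℝ) = ((n : ℝ) + 1) * n.choose j := by
  rcases le_or_gt j (n + 1) with h | h
  · have := Nat.choose_mul_succ_eq n j
    have h2 : ((n.choose j * (n + 1) : ℕ) : ℝ) = (((n + 1).choose j * (n + 1 - j) : ℕ) : ℝ) := by
      rw [this]
    push_cast [Nat.cast_sub h] at h2
    linarith
  · simp [Nat.choose_eq_zero_of_lt h, Nat.choose_eq_zero_of_lt ((Nat.lt_succ_self n).trans h)]

/-- The coefficients of the quadratic transformation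
`₂F₁(1/4,1/4;1;4x(1-x)) = ₂F₁(1/2,1/2;1;x)`. -/
theorem sum_antidiagonal_pochRatio_quarter_choose (n : ℕ) :
    ∑ p ∈ antidiagonal n, pochRatio (1 / 4) p.1 ^ 2 * 4 ^ p.1 * (p.1.choose p.2 * (-1) ^ p.2) =
      pochRatio (1 / 2) n ^ 2 := by
  induction n with
  | zero => simp
  | succ n ih =>
    have hn : ((n : ℝ) + 1) ^ 2 ≠ 0 := by positivity
    apply mul_left_cancel₀ hn
    set c : ℕ → ℕ → ℝ := fun i j => pochRatio (1 / 4) i ^ 2 * 4 ^ i * (i.choose j * (-1) ^ j)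
      with hc
    have rec1 : ∀ i j : ℕ, ((i : ℝ) + 1) * ((i : ℝ) + 1 - j) * c (i + 1) j =
        4 * (1 / 4 + i) ^ 2 * c i j := by
      intro i j
      have hi : ((i : ℝ) + 1) ≠ 0 := by positivity
      apply mul_left_cancel₀ hi
      simp only [hc, pow_succ (4 : ℝ)]
      linear_combination (((i : ℝ) + 1) * pochRatio (1 / 4) (i + 1) + (1 / 4 + i) *
          pochRatio (1 / 4) i) * 4 ^ i * 4 * ((i : ℝ) + 1 - j) * ((i + 1).choose j * (-1) ^ j) *
          succ_mul_pochRatio_succ (1 / 4) i +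
        (1 / 4 + i) ^ 2 * pochRatio (1 / 4) i ^ 2 * 4 ^ i * 4 * (-1) ^ j *
          cast_succ_sub_mul_choose i j
    have rec2 : ∀ i j : ℕ, ((j : ℝ) + 1) * c i (j + 1) = -((i : ℝ) - j) * c i j := by
      intro i j
      simp only [hc, pow_succ (-1 : ℝ)]
      linear_combination -(pochRatio (1 / 4) i ^ 2 * 4 ^ i * (-1) ^ j) *
        cast_succ_mul_choose_succ i j
    -- The splitting here is `(i+j)² = i(i-j) + j(3i+j)`, with factors matched to `rec1` and `rec2`;
    -- the shifted weights add up to `(i+j+1/2)²`.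
    have e1 := sum_antidiagonal_succ_fst_mul n fun i j => ((i : ℝ) - j) * c i j
    have e2 := sum_antidiagonal_succ_snd_mul n fun i j => (3 * (i : ℝ) + j) * c i j
    have e3 : ((n : ℝ) + 1) ^ 2 * ∑ p ∈ antidiagonal (n + 1), c p.1 p.2 =
        ∑ p ∈ antidiagonal (n + 1), ((p.1 : ℝ) * ((p.1 - p.2) * c p.1 p.2)) +
        ∑ p ∈ antidiagonal (n + 1), ((p.2 : ℝ) * ((3 * p.1 + p.2) * c p.1 p.2)) := by
      rw [← sum_add_distrib, mul_sum]
      refine sum_congr rfl fun p hp => ?_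
      have h := cast_add_of_mem_antidiagonal hp
      push_cast at h
      rw [← h]; ring
    have e4 : (((n : ℝ) + 1) * pochRatio (1 / 2) (n + 1)) ^ 2 =
        ∑ p ∈ antidiagonal n, (1 / 2 + (n : ℝ)) ^ 2 * c p.1 p.2 := by
      rw [succ_mul_pochRatio_succ, mul_pow, ← ih, mul_sum]
    rw [← mul_pow, e4]
    refine e3.trans ?_
    rw [e1, e2, ← sum_add_distrib]
    refine sum_congr rfl fun p hp => ?_
    have h := cast_add_of_mem_antidiagonal hp
    rw [← h]
    push_cast
    linear_combination rec1 p.1 p.2 + (3 * (p.1 : ℝ) + p.2 + 1) * rec2 p.1 p.2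

/-- The average of an even Legendre polynomial against the weight with moments
`((1/2)ᵢ / i!)²`, in terms of the expansion of `(1 - 2ut + t²)^(-1/2)` in powers of `2ut - t²`. -/
theorem sum_antidiagonal_legendre_moment (m : ℕ) :
    ∑ p ∈ antidiagonal m, pochRatio (1 / 2) (2 * p.1 + p.2) * ((2 * p.1 + p.2).choose p.2) *
      4 ^ p.1 * (-1) ^ p.2 * pochRatio (1 / 2) p.1 ^ 2 = (-1) ^ m * pochRatio (1 / 2) m ^ 3 := by
  set c : ℕ → ℕ → ℝ := fun i j => pochRatio (1 / 2) (2 * i + j) * ((2 * i + j).choose j) *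
      4 ^ i * (-1) ^ j * pochRatio (1 / 2) i ^ 2 with hc
  have rec2 : ∀ i j : ℕ, ((j : ℝ) + 1) * c i (j + 1) = -(2 * i + j + 1 / 2) * c i j := by
    intro i j
    have h1 := succ_mul_pochRatio_succ (1 / 2) (2 * i + j)
    have h2 := cast_succ_mul_choose_succ (2 * i + j + 1) j
    have h3 := cast_succ_sub_mul_choose (2 * i + j) j
    have hi : ((2 * i + j : ℕ) : ℝ) + 1 ≠ 0 := by positivity
    apply mul_left_cancel₀ hi
    simp only [hc, pow_succ (-1 : ℝ), ← add_assoc]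
    push_cast at h1 h2 h3 ⊢
    linear_combination -(4 ^ i * (-1) ^ j * pochRatio (1 / 2) i ^ 2) * (
      ((j : ℝ) + 1) * ((2 * i + j + 1).choose (j + 1)) * h1 +
      (1 / 2 + (2 * i + j)) * pochRatio (1 / 2) (2 * i + j) * (h2 + h3))
  have rec1 : ∀ i j : ℕ, ((i : ℝ) + 1) ^ 3 * c (i + 1) j =
      (2 * i + j + 1 / 2) * (2 * i + j + 3 / 2) * (i + 1 / 2) * c i j := by
    intro i j
    have h0 := succ_mul_pochRatio_succ (1 / 2) i
    have h1 := succ_mul_pochRatio_succ (1 / 2) (2 * i + j)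
    have h2 := succ_mul_pochRatio_succ (1 / 2) (2 * i + j + 1)
    have h3 := cast_succ_sub_mul_choose (2 * i + j) j
    have h4 := cast_succ_sub_mul_choose (2 * i + j + 1) j
    have e : 2 * (i + 1) + j = 2 * i + j + 1 + 1 := by ring
    simp only [hc, pow_succ (4 : ℝ), e]
    push_cast at h0 h1 h2 h3 h4 ⊢
    generalize pochRatio (1 / 2) (2 * i + j + 1 + 1) = B2 at *
    generalize pochRatio (1 / 2) (2 * i + j + 1) = B1 at *
    generalize pochRatio (1 / 2) (2 * i + j) = B0 at *
    generalize pochRatio (1 / 2) (i + 1) = A1 at *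
    generalize pochRatio (1 / 2) i = A0 at *
    generalize ((2 * i + j + 1 + 1).choose j : ℝ) = C2 at *
    generalize ((2 * i + j + 1).choose j : ℝ) = C1 at *
    generalize ((2 * i + j).choose j : ℝ) = C0 at *
    generalize (4 : ℝ) ^ i = F at *
    generalize (-1 : ℝ) ^ j = S at *
    have p1 : (0 : ℝ) < 2 * i + j + 1 := by positivity
    have p2 : (0 : ℝ) < 2 * i + j + 2 := by positivity
    have p3 : (0 : ℝ) < 2 * i + 1 := by positivity
    have p4 : (0 : ℝ) < i + 1 := by positivity
    have hA : A1 = (1 / 2 + i) * A0 / (i + 1) := by field_simp; linear_combination 2 * h0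
    have hB1 : B1 = (1 / 2 + (2 * i + j)) * B0 / (2 * i + j + 1) := by
      field_simp; linear_combination 2 * h1
    have hB2 : B2 = (1 / 2 + (2 * i + j + 1)) * B1 / (2 * i + j + 2) := by
      field_simp; linear_combination 2 * h2
    have hC1 : C1 = (2 * i + j + 1) * C0 / (2 * i + 1) := by
      field_simp; linear_combination h3
    have hC2 : C2 = (2 * i + j + 2) * C1 / (2 * i + 2) := by
      field_simp; linear_combination h4
    rw [hA, hB2, hB1, hC2, hC1]
    field_simp
    ring
  -- A null combination: after the shifts `i → i+1` and `j → j+1`, the two parts of the weight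
  -- cancel by `rec1` and `rec2`.
  have key : ∀ m : ℕ, ∑ p ∈ antidiagonal m, ((p.1 : ℝ) ^ 3 +
      (2 * p.1 + p.2 + 1 / 2) * (p.1 + 1 / 2) * p.2) * c p.1 p.2 = 0 := by
    intro m
    rcases m with _ | m
    · simp
    have e1 := sum_antidiagonal_succ_fst_mul m fun i j => (i : ℝ) ^ 2 * c i j
    have e2 := sum_antidiagonal_succ_snd_mul m
      fun i j => (2 * i + j + 1 / 2) * (i + 1 / 2) * c i j
    have e3 : ∑ p ∈ antidiagonal (m + 1), ((p.1 : ℝ) ^ 3 +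
        (2 * p.1 + p.2 + 1 / 2) * (p.1 + 1 / 2) * p.2) * c p.1 p.2 =
        ∑ p ∈ antidiagonal (m + 1), (p.1 : ℝ) * ((p.1 : ℝ) ^ 2 * c p.1 p.2) +
        ∑ p ∈ antidiagonal (m + 1), (p.2 : ℝ) * ((2 * p.1 + p.2 + 1 / 2) * (p.1 + 1 / 2) *
          c p.1 p.2) := by
      rw [← sum_add_distrib]
      exact sum_congr rfl fun p _ => by ring
    rw [e3, e1, e2, ← sum_add_distrib]
    refine sum_eq_zero fun p _ => ?_
    push_cast
    linear_combination rec1 p.1 p.2 + (2 * p.1 + p.2 + 3 / 2) * (p.1 + 1 / 2) * rec2 p.1 p.2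
  induction m with
  | zero => simp
  | succ n ih =>
    have hn : ((n : ℝ) + 1) ^ 3 ≠ 0 := by positivity
    apply mul_left_cancel₀ hn
    have e1 := sum_antidiagonal_succ_fst_mul n fun i j => (i : ℝ) ^ 2 * c i j
    have e2 := sum_antidiagonal_succ_snd_mul n
      fun i j => (3 * (i : ℝ) ^ 2 + 3 * i * j + j ^ 2) * c i j
    have e3 : ((n : ℝ) + 1) ^ 3 * ∑ p ∈ antidiagonal (n + 1), c p.1 p.2 =
        ∑ p ∈ antidiagonal (n + 1), ((p.1 : ℝ) * ((p.1 : ℝ) ^ 2 * c p.1 p.2)) +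
        ∑ p ∈ antidiagonal (n + 1), ((p.2 : ℝ) * ((3 * (p.1 : ℝ) ^ 2 + 3 * p.1 * p.2 + p.2 ^ 2) *
          c p.1 p.2)) := by
      rw [← sum_add_distrib, mul_sum]
      refine sum_congr rfl fun p hp => ?_
      have h := cast_add_of_mem_antidiagonal hp
      push_cast at h
      rw [← h]; ring
    have e4 : ((n : ℝ) + 1) ^ 3 * ((-1) ^ (n + 1) * pochRatio (1 / 2) (n + 1) ^ 3) =
        ∑ p ∈ antidiagonal n, -(1 / 2 + (n : ℝ)) ^ 3 * c p.1 p.2 := by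
      rw [← mul_sum, ih]
      linear_combination -(-1) ^ n * congrArg (· ^ 3) (succ_mul_pochRatio_succ (1 / 2) n)
    rw [e4]
    refine e3.trans ?_
    rw [e1, e2, ← sum_add_distrib, ← sub_eq_zero, ← sum_sub_distrib]
    -- Unlike in the two preceding identities, the summands do not agree termwise: they differ by
    -- minus the summand of `key n`, whose total is zero.
    refine Eq.trans ?_ (neg_eq_zero.2 (key n))
    rw [← sum_neg_distrib]
    refine sum_congr rfl fun p hp => ?_
    have h := cast_add_of_mem_antidiagonal hp
    rw [← h]
    push_cast
    linear_combination rec1 p.1 p.2 +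
      (3 * (p.1 : ℝ) ^ 2 + 3 * p.1 * (p.2 + 1) + (p.2 + 1) ^ 2) * rec2 p.1 p.2

end Coefficients

/-! ### Binomial series, the series of `K`, and rearrangement along antidiagonals. -/

section PowerSeries

open Finset

lemma ring_choose_eq_pochRatio (α : ℝ) (n : ℕ) :
    Ring.choose ((α : ℂ) + n - 1) n = (pochRatio α n : ℂ) := by
  rw [Ring.choose_eq_smul, Polynomial.descPochhammer_smeval_eq_ascPochhammer,
    Polynomial.ascPochhammer_smeval_eq_eval,
    show (α : ℂ) + n - 1 - n + 1 = α by ring]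
  induction n with
  | zero => simp
  | succ n ih =>
    have h := congrArg (fun x : ℝ => (x : ℂ)) (succ_mul_pochRatio_succ α n)
    push_cast at h
    have hn : ((n : ℂ) + 1) ≠ 0 := by exact_mod_cast n.succ_ne_zero
    apply mul_left_cancel₀ hn
    rw [h, ← ih, ascPochhammer_succ_eval, Nat.factorial_succ]
    simp only [smul_eq_mul]
    push_cast
    field_simp

lemma hasSum_one_sub_cpow_neg_half {z : ℂ} (hz : ‖z‖ < 1) :
    HasSum (fun n => (pochRatio (1 / 2) n : ℂ) * z ^ n) ((1 - z) ^ (-(1 / 2) : ℂ)) := by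
  have h := (Complex.one_div_one_sub_cpow_hasFPowerSeriesOnBall_zero (1 / 2 : ℂ)).hasSum
    (y := z) (by simpa [enorm_eq_nnnorm, ← NNReal.coe_lt_one] using hz)
  rw [Complex.cpow_neg, ← one_div]
  have e := ring_choose_eq_pochRatio (1 / 2)
  push_cast at e
  simpa only [FormalMultilinearSeries.ofScalars_apply_eq, e, zero_add, smul_eq_mul] using h

lemma hasSum_one_div_sqrt_one_sub {y : ℝ} (hy : |y| < 1) :
    HasSum (fun n => pochRatio (1 / 2) n * y ^ n) (1 / Real.sqrt (1 - y)) := by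
  have h := hasSum_one_sub_cpow_neg_half (z := (y : ℂ)) (by simpa using hy)
  have hy' : 0 ≤ 1 - y := by linarith [le_abs_self y]
  have e : 1 / Real.sqrt (1 - y) = (1 - y) ^ (-(1 / 2) : ℝ) := by
    rw [Real.rpow_neg hy', Real.sqrt_eq_rpow, one_div]
  rw [← Complex.hasSum_ofReal, e, Complex.ofReal_cpow hy']
  push_cast
  exact h

lemma integral_sin_pow_two_mul_zero_pi_div_two (n : ℕ) :
    ∫ θ in (0 : ℝ)..(Real.pi / 2), Real.sin θ ^ (2 * n) = Real.pi / 2 * pochRatio (1 / 2) n := by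
  have h1 := integral_sin_pow_even n
  have h2 := EulerSine.integral_cos_pow_eq (2 * n)
  have h3 := intervalIntegral.integral_comp_sub_left (a := 0) (b := Real.pi / 2)
    (fun θ => Real.sin θ ^ (2 * n)) (Real.pi / 2)
  simp only [Real.sin_pi_div_two_sub, sub_self, sub_zero] at h3
  rw [← h3, h2, h1, pochRatio, ← mul_assoc]
  congr 1
  · ring
  · refine prod_congr rfl fun i _ => ?_
    field_simp
    ring

/-- The expansion of the complete elliptic integral in powers of the modulus. -/
lemma hasSum_ellipticK {k : ℝ} (hk : k ^ 2 < 1) :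
    HasSum (fun n => pochRatio (1 / 2) n ^ 2 * (k ^ 2) ^ n) (2 / Real.pi * ellipticK k) := by
  have hπ := Real.pi_pos
  have hb : ∀ θ : ℝ, ∀ n : ℕ,
      ‖pochRatio (1 / 2) n * (k ^ 2 * Real.sin θ ^ 2) ^ n‖ ≤ (k ^ 2) ^ n := by
    intro θ n
    have h0 := pochRatio_nonneg (α := 1 / 2) (by norm_num) n
    have h1 := pochRatio_le_one (α := 1 / 2) (by norm_num) (by norm_num) n
    have h2 : k ^ 2 * Real.sin θ ^ 2 ≤ k ^ 2 :=
      mul_le_of_le_one_right (sq_nonneg k) (Real.sin_sq_le_one θ)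
    rw [Real.norm_of_nonneg (by positivity)]
    exact (mul_le_of_le_one_left (by positivity) h1).trans (pow_le_pow_left₀ (by positivity) h2 n)
  have key := intervalIntegral.hasSum_integral_of_dominated_convergence
    (μ := MeasureTheory.volume) (a := 0) (b := Real.pi / 2)
    (F := fun n θ => pochRatio (1 / 2) n * (k ^ 2 * Real.sin θ ^ 2) ^ n)
    (f := fun θ => 1 / Real.sqrt (1 - k ^ 2 * Real.sin θ ^ 2))
    (fun n _ => (k ^ 2) ^ n)
    (fun n => by
      refine Continuous.aestronglyMeasurable ?_
      fun_prop)
    (fun n => Filter.Eventually.of_forall fun θ _ => hb θ n)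
    (Filter.Eventually.of_forall fun θ _ => summable_geometric_of_lt_one (sq_nonneg k) hk)
    (by simp)
    (Filter.Eventually.of_forall fun θ _ => by
      apply hasSum_one_div_sqrt_one_sub
      rw [abs_of_nonneg (by positivity)]
      exact (mul_le_of_le_one_right (sq_nonneg k) (Real.sin_sq_le_one θ)).trans_lt hk)
  have h := key.mul_left (2 / Real.pi)
  rw [ellipticK]
  refine h.congr_fun fun n => ?_
  have : ∀ θ : ℝ, pochRatio (1 / 2) n * (k ^ 2 * Real.sin θ ^ 2) ^ n =
      (pochRatio (1 / 2) n * (k ^ 2) ^ n) * Real.sin θ ^ (2 * n) := by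
    intro θ; rw [mul_pow, ← pow_mul (Real.sin θ)]; ring
  simp only [this, intervalIntegral.integral_const_mul, integral_sin_pow_two_mul_zero_pi_div_two]
  field_simp

/-- The binomial theorem summed over all of `ℕ`: coefficients with `j > n` vanish, so the truncated
`n - j` is harmless and the double family can be indexed by `ℕ × ℕ`. -/
lemma hasSum_mul_choose_mul_pow {𝕜 : Type*} [RCLike 𝕜] (a x y : 𝕜) (n : ℕ) :
    HasSum (fun j => a * ((n.choose j : 𝕜) * x ^ (n - j) * y ^ j)) (a * (x + y) ^ n) := by
  refine HasSum.mul_left _ ?_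
  have e : (x + y) ^ n = ∑ j ∈ range (n + 1), (n.choose j : 𝕜) * x ^ (n - j) * y ^ j := by
    rw [add_comm x y, add_pow]
    exact sum_congr rfl fun j _ => by ring
  rw [e]
  refine hasSum_sum_of_ne_finset_zero fun j hj => ?_
  rw [Nat.choose_eq_zero_of_lt (by simpa using hj)]
  simp

/-- Regrouping `∑ c n * (u + v) ^ n` along antidiagonals after expanding the powers. -/
lemma hasSum_antidiagonal_choose {𝕜 : Type*} [RCLike 𝕜] {c : ℕ → 𝕜} {u v : 𝕜}
    (h : Summable fun n => ‖c n‖ * (‖u‖ + ‖v‖) ^ n) :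
    HasSum (fun N => ∑ p ∈ antidiagonal N,
      c p.1 * (p.1.choose p.2 * u ^ (p.1 - p.2) * v ^ p.2)) (∑' n, c n * (u + v) ^ n) := by
  set g : ℕ × ℕ → 𝕜 := fun p => c p.1 * (p.1.choose p.2 * u ^ (p.1 - p.2) * v ^ p.2) with hg
  have row : ∀ n, HasSum (fun j => g (n, j)) (c n * (u + v) ^ n) :=
    fun n => hasSum_mul_choose_mul_pow (c n) u v n
  -- The same binomial identity applied to the norms gives absolute summability of the double
  -- family.
  have rowR : ∀ n, HasSum (fun j => ‖g (n, j)‖) (‖c n‖ * (‖u‖ + ‖v‖) ^ n) := by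
    intro n
    have := hasSum_mul_choose_mul_pow ‖c n‖ ‖u‖ ‖v‖ n
    simpa [hg] using this
  have hs : Summable g := by
    apply Summable.of_norm
    rw [summable_prod_of_nonneg fun p => norm_nonneg _]
    exact ⟨fun n => (rowR n).summable, by simpa only [(rowR _).tsum_eq] using h⟩
  have h1 : HasSum g (∑' n, c n * (u + v) ^ n) := by
    have e : ∑' p, g p = ∑' n, c n * (u + v) ^ n :=
      (hs.tsum_prod' fun n => (row n).summable).trans (tsum_congr fun n => (row n).tsum_eq)
    exact e ▸ hs.hasSum
  have h2 := (HasAntidiagonal.sigmaAntidiagonalEquivProd (A := ℕ)).hasSum_iff.2 h1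
  refine h2.sigma fun n => ?_
  have h3 := hasSum_fintype fun x : antidiagonal n => g x
  rwa [Finset.univ_eq_attach, sum_attach (antidiagonal n) g] at h3

end PowerSeries

/-! ### The cubic series at `1/4` and the modulus `k₃`. -/

section SingularModulus

open Finset

/-- The singular modulus `k₃`, with `k₃² = (2 - √3) / 4`. -/
noncomputable def singularModulusThree : ℝ := Real.sqrt ((2 - Real.sqrt 3) / 4)

lemma sqrt_three_bounds : 1.73 < Real.sqrt 3 ∧ Real.sqrt 3 < 1.74 := by
  constructor
  · rw [Real.lt_sqrt (by norm_num)]; norm_num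
  · rw [Real.sqrt_lt' (by norm_num)]; norm_num

lemma singularModulusThree_sq : singularModulusThree ^ 2 = (2 - Real.sqrt 3) / 4 := by
  rw [singularModulusThree, Real.sq_sqrt]
  linarith [sqrt_three_bounds.2]

/-- `∑ (C(2n,n) / 4ⁿ)³ / 4ⁿ = (2 K(k₃) / π)²`. -/
theorem tsum_pochRatio_half_cube :
    ∑' n, pochRatio (1 / 2) n ^ 3 * (1 / 4 : ℝ) ^ n =
      (2 / Real.pi * ellipticK singularModulusThree) ^ 2 := by
  have b := sqrt_three_bounds
  have a0 : ∀ n, 0 ≤ pochRatio (1 / 4) n ^ 2 := fun n => sq_nonneg _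
  have a1 : ∀ n, pochRatio (1 / 4) n ^ 2 ≤ 1 := fun n =>
    pow_le_one₀ (pochRatio_nonneg (by norm_num) n) (pochRatio_le_one (by norm_num) (by norm_num) n)
  have hgeom : ∀ r : ℝ, 0 ≤ r → r < 1 → Summable fun n => pochRatio (1 / 4) n ^ 2 * r ^ n :=
    fun r h0 h1 => Summable.of_nonneg_of_le (fun n => mul_nonneg (a0 n) (pow_nonneg h0 n))
      (fun n => mul_le_of_le_one_left (pow_nonneg h0 n) (a1 n)) (summable_geometric_of_lt_one h0 h1)
  set x := singularModulusThree ^ 2 with hx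
  have hxv : x = (2 - Real.sqrt 3) / 4 := singularModulusThree_sq
  have hx0 : 0 ≤ x := sq_nonneg _
  -- Taking norms replaces `x - x²` by `x + x²`, so the rearrangement needs `4(x + x²) < 1`.
  have hx1 : x < 0.07 := by rw [hxv]; linarith
  have hx4 : 4 * (x + -x ^ 2) = 1 / 4 := by
    have := Real.sq_sqrt (show (0 : ℝ) ≤ 3 by norm_num)
    rw [hxv]; linear_combination -(1 / 4) * this
  have h1 : ∑' n, pochRatio (1 / 4) n ^ 2 * (1 / 4 : ℝ) ^ n =
      2 / Real.pi * ellipticK singularModulusThree := by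
    have key := hasSum_antidiagonal_choose (c := fun n => pochRatio (1 / 4) n ^ 2 * 4 ^ n)
      (u := x) (v := -x ^ 2) (by
        refine (hgeom (4 * (x + x ^ 2)) (by positivity) (by nlinarith)).congr fun n => ?_
        rw [Real.norm_of_nonneg (by positivity), norm_neg, Real.norm_of_nonneg hx0,
          Real.norm_of_nonneg (by positivity), mul_pow]
        ring)
    have e1 : ∑' n, pochRatio (1 / 4) n ^ 2 * 4 ^ n * (x + -x ^ 2) ^ n =
        ∑' n, pochRatio (1 / 4) n ^ 2 * (1 / 4 : ℝ) ^ n :=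
      tsum_congr fun n => by rw [mul_assoc, ← mul_pow, hx4]
    rw [e1] at key
    refine key.unique ((hasSum_ellipticK (by rw [← hx]; linarith)).congr_fun fun n => ?_)
    rw [← sum_antidiagonal_pochRatio_quarter_choose, sum_mul]
    refine sum_congr rfl fun p hp => ?_
    rw [HasAntidiagonal.mem_antidiagonal] at hp
    rcases le_or_gt p.2 p.1 with h | h
    · rw [← hx, ← hp]
      obtain ⟨d, hd⟩ := Nat.exists_eq_add_of_le h
      rw [hd, Nat.add_sub_cancel_left, neg_pow]
      ring
    · rw [Nat.choose_eq_zero_of_lt h]; simp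
  have hs := hgeom (1 / 4) (by norm_num) (by norm_num)
  have hs' : Summable fun n => ‖pochRatio (1 / 4) n ^ 2 * (1 / 4 : ℝ) ^ n‖ := hs.norm
  rw [← h1, sq, tsum_mul_tsum_eq_tsum_sum_antidiagonal_of_summable_norm hs' hs']
  refine tsum_congr fun n => ?_
  rw [← sum_antidiagonal_pochRatio_quarter_sq, sum_mul]
  refine sum_congr rfl fun p hp => ?_
  rw [← mem_antidiagonal.1 hp]
  ring

end SingularModulus

/-! ### Evaluation of `K(k₃)` by the beta integral `B(1/6, 1/2)`. -/

section GammaEvaluation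

open Finset

/-- The beta integral as a real set integral. -/
lemma setIntegral_Ioo_rpow_mul_one_sub_rpow {α β : ℝ} (hα : 0 < α) (hβ : 0 < β) :
    ∫ x in Set.Ioo (0 : ℝ) 1, x ^ (α - 1) * (1 - x) ^ (β - 1) =
      Real.Gamma α * Real.Gamma β / Real.Gamma (α + β) := by
  have h := ProbabilityTheory.beta_eq_betaIntegralReal α β hα hβ
  rw [ProbabilityTheory.beta] at h
  have e : Complex.betaIntegral α β =
      ((∫ x in Set.Ioo (0 : ℝ) 1, x ^ (α - 1) * (1 - x) ^ (β - 1) : ℝ) : ℂ) := by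
    rw [Complex.betaIntegral, intervalIntegral.integral_of_le zero_le_one,
      MeasureTheory.integral_Ioc_eq_integral_Ioo, ← integral_complex_ofReal]
    refine MeasureTheory.setIntegral_congr_fun measurableSet_Ioo fun x hx => ?_
    have h1 : (0 : ℝ) ≤ 1 - x := by linarith [hx.2]
    rw [Complex.ofReal_mul, Complex.ofReal_cpow hx.1.le, Complex.ofReal_cpow h1]
    push_cast
    rfl
  rw [h, e, Complex.ofReal_re]

/-- The Möbius map whose cube, precomposed with `cos`, turns the beta integral `B(1/6, 1/2)` into
an elliptic integral of modulus `k₃`. -/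
noncomputable def equianharmonicMap (c : ℝ) : ℝ :=
  (1 + c) / (1 + Real.sqrt 3 + (1 - Real.sqrt 3) * c)

lemma equianharmonicMap_denom_pos {c : ℝ} (h1 : c ≤ 1) :
    0 < 1 + Real.sqrt 3 + (1 - Real.sqrt 3) * c := by
  nlinarith [sqrt_three_bounds.1]

lemma equianharmonicMap_inj {c d : ℝ} (hc : c ≤ 1) (hd : d ≤ 1)
    (h : equianharmonicMap c = equianharmonicMap d) : c = d := by
  rw [equianharmonicMap, equianharmonicMap, div_eq_div_iff (equianharmonicMap_denom_pos hc).ne'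
    (equianharmonicMap_denom_pos hd).ne'] at h
  have h3 : 2 * Real.sqrt 3 ≠ 0 := by positivity
  apply mul_left_cancel₀ h3
  linear_combination h

lemma equianharmonicMap_pos {c : ℝ} (h0 : -1 < c) (h1 : c ≤ 1) : 0 < equianharmonicMap c :=
  div_pos (by linarith) (equianharmonicMap_denom_pos h1)

lemma hasDerivAt_equianharmonicMap {c : ℝ} (h1 : c ≤ 1) :
    HasDerivAt equianharmonicMap
      (2 * Real.sqrt 3 / (1 + Real.sqrt 3 + (1 - Real.sqrt 3) * c) ^ 2) c := by
  have hD := equianharmonicMap_denom_pos h1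
  have hn : HasDerivAt (fun c : ℝ => 1 + c) 1 c := (hasDerivAt_id c).const_add 1
  have hd : HasDerivAt (fun c : ℝ => 1 + Real.sqrt 3 + (1 - Real.sqrt 3) * c)
      (1 - Real.sqrt 3) c := by
    simpa using ((hasDerivAt_id c).const_mul (1 - Real.sqrt 3)).const_add (1 + Real.sqrt 3)
  refine (hn.div hd hD.ne').congr_deriv ?_
  congr 1
  ring

lemma image_equianharmonicMap :
    (fun φ => equianharmonicMap (Real.cos φ) ^ 3) '' Set.Ioo 0 Real.pi = Set.Ioo 0 1 := by
  have b := sqrt_three_bounds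
  ext y
  simp only [Set.mem_image, Set.mem_Ioo]
  constructor
  · rintro ⟨φ, ⟨h0, h1⟩, rfl⟩
    have hc0 : -1 < Real.cos φ := by
      rw [← Real.cos_pi]; exact Real.cos_lt_cos_of_nonneg_of_le_pi h0.le le_rfl h1
    have hc1 : Real.cos φ < 1 := by
      rw [← Real.cos_zero]; exact Real.cos_lt_cos_of_nonneg_of_le_pi le_rfl h1.le h0
    have hp := equianharmonicMap_pos hc0 hc1.le
    refine ⟨by positivity, pow_lt_one₀ hp.le ?_ (by norm_num)⟩
    rw [equianharmonicMap, div_lt_one (equianharmonicMap_denom_pos hc1.le)]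
    nlinarith
  · rintro ⟨h0, h1⟩
    set q := y ^ (1 / 3 : ℝ) with hq
    have hq0 : 0 < q := Real.rpow_pos_of_pos h0 _
    have hq1 : q < 1 := Real.rpow_lt_one h0.le h1 (by norm_num)
    have hq3 : q ^ 3 = y := by
      rw [hq, ← Real.rpow_natCast, ← Real.rpow_mul h0.le]; norm_num
    have hE : 0 < 1 + q * (Real.sqrt 3 - 1) := by nlinarith
    -- The inverse Möbius map at the cube root `q` of `y`.
    set c := (q * (1 + Real.sqrt 3) - 1) / (1 + q * (Real.sqrt 3 - 1)) with hc
    have hc0 : -1 < c := by rw [hc, lt_div_iff₀ hE]; nlinarith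
    have hc1 : c < 1 := by rw [hc, div_lt_one hE]; nlinarith
    refine ⟨Real.arccos c, ⟨Real.arccos_pos.2 hc1, ?_⟩, ?_⟩
    · exact lt_of_le_of_ne (Real.arccos_le_pi c) fun h => by
        rw [Real.arccos_eq_pi] at h; linarith
    · rw [Real.cos_arccos hc0.le hc1.le, ← hq3]
      congr 1
      rw [equianharmonicMap, div_eq_iff (equianharmonicMap_denom_pos hc1.le).ne', hc]
      field_simp
      ring

lemma continuous_ellipticK_integrand {k : ℝ} (hk : k ^ 2 < 1) :
    Continuous fun θ => 1 / Real.sqrt (1 - k ^ 2 * Real.sin θ ^ 2) := by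
  refine continuous_const.div (by fun_prop) fun φ => ?_
  have : k ^ 2 * Real.sin φ ^ 2 < 1 :=
    (mul_le_of_le_one_right (sq_nonneg k) (Real.sin_sq_le_one φ)).trans_lt hk
  exact (Real.sqrt_pos.2 (by linarith)).ne'

lemma integral_zero_pi_one_div_sqrt (k : ℝ) (hk : k ^ 2 < 1) :
    ∫ φ in Set.Ioo 0 Real.pi, 1 / Real.sqrt (1 - k ^ 2 * Real.sin φ ^ 2) = 2 * ellipticK k := by
  have hc := continuous_ellipticK_integrand hk
  have h := intervalIntegral.integral_comp_sub_left (a := Real.pi / 2) (b := Real.pi)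
    (fun φ => 1 / Real.sqrt (1 - k ^ 2 * Real.sin φ ^ 2)) Real.pi
  simp only [Real.sin_pi_sub, sub_self] at h
  rw [show Real.pi - Real.pi / 2 = Real.pi / 2 by ring] at h
  rw [← MeasureTheory.integral_Ioc_eq_integral_Ioo,
    ← intervalIntegral.integral_of_le Real.pi_pos.le,
    ← intervalIntegral.integral_add_adjacent_intervals (hc.intervalIntegrable 0 (Real.pi / 2))
      (hc.intervalIntegrable (Real.pi / 2) Real.pi), h, ellipticK]
  ring

/-- Squaring both (nonnegative) sides removes the half-integral powers; the factorisation of `1 -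
q³` then cancels every power of the denominator `D`, leaving `3√3` over `1 - k₃² sin² φ`. -/
lemma equianharmonic_integrand_sq {φ : ℝ} (h0 : 0 < φ) (h1 : φ < Real.pi) :
    |3 * equianharmonicMap (Real.cos φ) ^ 2 * (2 * Real.sqrt 3 /
        (1 + Real.sqrt 3 + (1 - Real.sqrt 3) * Real.cos φ) ^ 2 * -Real.sin φ)| *
      ((equianharmonicMap (Real.cos φ) ^ 3) ^ (1 / 6 - 1 : ℝ) *
        (1 - equianharmonicMap (Real.cos φ) ^ 3) ^ (1 / 2 - 1 : ℝ)) =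
    Real.sqrt (3 * Real.sqrt 3) *
      (1 / Real.sqrt (1 - singularModulusThree ^ 2 * Real.sin φ ^ 2)) := by
  have b := sqrt_three_bounds
  have hs3 := Real.sq_sqrt (show (0 : ℝ) ≤ 3 by norm_num)
  have hsc := Real.sin_sq_add_cos_sq φ
  have hs : 0 < Real.sin φ := Real.sin_pos_of_pos_of_lt_pi h0 h1
  have hc0 : -1 < Real.cos φ := by
    rw [← Real.cos_pi]; exact Real.cos_lt_cos_of_nonneg_of_le_pi h0.le le_rfl h1
  have hc1 : Real.cos φ < 1 := by
    rw [← Real.cos_zero]; exact Real.cos_lt_cos_of_nonneg_of_le_pi le_rfl h1.le h0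
  have hq := equianharmonicMap_pos hc0 hc1.le
  have hD := equianharmonicMap_denom_pos hc1.le
  have hqlt : equianharmonicMap (Real.cos φ) < 1 := by
    rw [equianharmonicMap, div_lt_one hD]; nlinarith
  have hW : 0 < 1 - singularModulusThree ^ 2 * Real.sin φ ^ 2 := by
    rw [singularModulusThree_sq]; nlinarith [Real.sin_sq_le_one φ]
  have hy : 0 < 1 - equianharmonicMap (Real.cos φ) ^ 3 := by
    linarith [pow_lt_one₀ hq.le hqlt (n := 3) (by norm_num)]
  refine (pow_left_inj₀ (n := 2) (by positivity) (by positivity) (by norm_num)).1 ?_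
  have e1 : ((equianharmonicMap (Real.cos φ) ^ 3) ^ (1 / 6 - 1 : ℝ)) ^ 2 =
      (equianharmonicMap (Real.cos φ) ^ 5)⁻¹ := by
    rw [← Real.rpow_natCast (_ ^ _) 2, ← Real.rpow_mul (by positivity),
      ← Real.rpow_natCast _ 3, ← Real.rpow_mul hq.le, ← Real.rpow_natCast _ 5,
      ← Real.rpow_neg hq.le]
    norm_num
  have e2 : ((1 - equianharmonicMap (Real.cos φ) ^ 3) ^ (1 / 2 - 1 : ℝ)) ^ 2 =
      (1 - equianharmonicMap (Real.cos φ) ^ 3)⁻¹ := by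
    rw [← Real.rpow_natCast _ 2, ← Real.rpow_mul hy.le, ← Real.rpow_neg_one]
    norm_num
  rw [mul_pow, sq_abs, mul_pow (_ ^ (1 / 6 - 1 : ℝ)), e1, e2, mul_pow (Real.sqrt _), div_pow 1,
    Real.sq_sqrt (by positivity), Real.sq_sqrt hW.le, one_pow, singularModulusThree_sq]
  rw [singularModulusThree_sq] at hW
  rw [equianharmonicMap] at hy ⊢
  set c := Real.cos φ
  set s := Real.sin φ
  set r := Real.sqrt 3
  set D := 1 + r + (1 - r) * c with hDdef
  have hs2 : s ^ 2 = (1 - c) * (1 + c) := by linear_combination hsc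
  -- Factor `D³ - (1+c)³`: the linear factor is `r(1-c)`, and the Möbius map is chosen so that the
  -- quadratic factor has no term linear in `c`, hence depends on `s²` only.
  have e3 : 1 - ((1 + c) / D) ^ 3 =
      12 * r * (1 - c) * (1 - (2 - r) / 4 * s ^ 2) / D ^ 3 := by
    field_simp
    rw [hs2, hDdef]
    ring_nf
    have h4 : r ^ 3 = 3 * r := by rw [pow_succ, hs3]
    rw [h4, hs3]
    ring
  rw [e3]
  have hc1' : 0 < 1 - c := by linarith
  have hc0' : 0 < 1 + c := by linarith
  have hr : 0 < r := by linarith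
  generalize hWd : 1 - (2 - r) / 4 * s ^ 2 = W at hW ⊢
  have hs3' : r ^ 3 = 3 * r := by rw [pow_succ, hs3]
  field_simp
  rw [hs2]
  ring_nf

/-- The singular value evaluation `K(k₃)² = √3 Γ(1/3)⁶ / (2^(14/3) π²)`, halved. -/
theorem ellipticK_singularModulusThree_sq_div_two :
    ellipticK singularModulusThree ^ 2 / 2 =
      Real.sqrt 3 * Real.Gamma (1 / 3) ^ 6 / ((2 : ℝ) ^ (17 / 3 : ℝ) * Real.pi ^ 2) := by
  have b := sqrt_three_bounds
  have hs3 := Real.sq_sqrt (show (0 : ℝ) ≤ 3 by norm_num)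
  have hB := setIntegral_Ioo_rpow_mul_one_sub_rpow (α := 1 / 6) (β := 1 / 2)
    (by norm_num) (by norm_num)
  have hcov := MeasureTheory.integral_image_eq_integral_abs_deriv_smul
    (s := Set.Ioo 0 Real.pi) (f := fun φ => equianharmonicMap (Real.cos φ) ^ 3)
    (f' := fun φ => 3 * equianharmonicMap (Real.cos φ) ^ 2 * (2 * Real.sqrt 3 /
        (1 + Real.sqrt 3 + (1 - Real.sqrt 3) * Real.cos φ) ^ 2 * -Real.sin φ)) measurableSet_Ioo
    (fun φ _ => by
      have h1 := (hasDerivAt_equianharmonicMap (Real.cos_le_one φ)).comp φ (Real.hasDerivAt_cos φ)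
      have h2 := (h1.pow 3).hasDerivWithinAt (s := Set.Ioo 0 Real.pi)
      simp only [Nat.cast_ofNat, Nat.add_one_sub_one, Function.comp_apply] at h2
      exact h2)
    (fun φ hφ ψ hψ h => by
      have hm : ∀ x ∈ Set.Ioo 0 Real.pi, 0 ≤ equianharmonicMap (Real.cos x) := fun x _ =>
        div_nonneg (by linarith [Real.neg_one_le_cos x])
          (equianharmonicMap_denom_pos (Real.cos_le_one x)).le
      have h1 := (pow_left_inj₀ (hm φ hφ) (hm ψ hψ) (by norm_num)).1 h
      exact Real.injOn_cos (Set.Ioo_subset_Icc_self hφ) (Set.Ioo_subset_Icc_self hψ)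
        (equianharmonicMap_inj (Real.cos_le_one _) (Real.cos_le_one _) h1))
    (fun x => x ^ (1 / 6 - 1 : ℝ) * (1 - x) ^ (1 / 2 - 1 : ℝ))
  rw [image_equianharmonicMap, hB] at hcov
  have hk : singularModulusThree ^ 2 < 1 := by rw [singularModulusThree_sq]; linarith
  have hcongr : ∫ φ in Set.Ioo 0 Real.pi, |3 * equianharmonicMap (Real.cos φ) ^ 2 *
      (2 * Real.sqrt 3 / (1 + Real.sqrt 3 + (1 - Real.sqrt 3) * Real.cos φ) ^ 2 * -Real.sin φ)| •
      ((equianharmonicMap (Real.cos φ) ^ 3) ^ (1 / 6 - 1 : ℝ) *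
        (1 - equianharmonicMap (Real.cos φ) ^ 3) ^ (1 / 2 - 1 : ℝ)) =
      Real.sqrt (3 * Real.sqrt 3) * (2 * ellipticK singularModulusThree) := by
    rw [← integral_zero_pi_one_div_sqrt _ hk, ← MeasureTheory.integral_const_mul]
    exact MeasureTheory.setIntegral_congr_fun measurableSet_Ioo fun φ hφ =>
      equianharmonic_integrand_sq hφ.1 hφ.2
  rw [hcongr] at hcov
  -- Duplication at `1/6` expresses `Γ(1/6)` by `Γ(1/3)` and `Γ(2/3)`; reflection at `1/3`
  -- eliminates `Γ(2/3)`.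
  have g1 := Real.Gamma_mul_Gamma_add_half (1 / 6)
  have g2 := Real.Gamma_mul_Gamma_one_sub (1 / 3)
  have g3 := Real.Gamma_one_half_eq
  rw [show Real.pi * (1 / 3) = Real.pi / 3 by ring, Real.sin_pi_div_three] at g2
  norm_num at g1 g2 g3 hcov ⊢
  have p1 : 0 < Real.Gamma (1 / 3) := Real.Gamma_pos_of_pos (by norm_num)
  have p2 : 0 < Real.Gamma (2 / 3) := Real.Gamma_pos_of_pos (by norm_num)
  -- The only relation needed between the fractional powers of 2; both then become free variables in
  -- a polynomial identity.
  have hpow : (2 : ℝ) ^ (17 / 3 : ℝ) * ((2 : ℝ) ^ (2 / 3 : ℝ)) ^ 2 = 2 ^ 7 := by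
    rw [← Real.rpow_natCast (_ ^ _) 2, ← Real.rpow_mul (by norm_num),
      ← Real.rpow_add (by norm_num), ← Real.rpow_natCast]
    norm_num
  have hT : 0 < (2 : ℝ) ^ (17 / 3 : ℝ) := by positivity
  have ht : 0 < (2 : ℝ) ^ (2 / 3 : ℝ) := by positivity
  have hv : Real.sqrt (Real.sqrt 3) ^ 2 = Real.sqrt 3 := Real.sq_sqrt (by positivity)
  have hπ := Real.pi_pos
  have hπ2 : Real.sqrt Real.pi ^ 2 = Real.pi := Real.sq_sqrt hπ.le
  have hr : 0 < Real.sqrt 3 := by linarith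
  rw [g3] at hcov
  have e2 : Real.Gamma (2 / 3) = 2 * Real.pi / (Real.sqrt 3 * Real.Gamma (1 / 3)) := by
    field_simp
    field_simp at g2
    linear_combination g2
  have e1 : Real.Gamma (1 / 6) = Real.Gamma (1 / 3) * 2 ^ (2 / 3 : ℝ) * Real.sqrt Real.pi /
      Real.Gamma (2 / 3) := by
    rw [eq_div_iff p2.ne', g1]
  rw [e1, e2] at hcov
  generalize Real.Gamma (1 / 3) = G at *
  generalize ellipticK singularModulusThree = K at *
  generalize (2 : ℝ) ^ (17 / 3 : ℝ) = T at *
  generalize (2 : ℝ) ^ (2 / 3 : ℝ) = t at *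
  generalize Real.sqrt (Real.sqrt 3) = v at *
  have hK : 8 * Real.pi * Real.sqrt 3 * v * K = 3 * t * G ^ 3 := by
    have h : G * t * Real.sqrt Real.pi / (2 * Real.pi / (Real.sqrt 3 * G)) * Real.sqrt Real.pi /
        (2 * Real.pi / (Real.sqrt 3 * G)) = 3 * t * G ^ 3 / (4 * Real.pi) := by
      field_simp
      rw [hπ2, hs3]
      ring
    rw [h] at hcov
    field_simp at hcov
    linear_combination -hcov
  have hK2 : 192 * Real.pi ^ 2 * Real.sqrt 3 * K ^ 2 = 9 * t ^ 2 * G ^ 6 := by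
    have := congrArg (· ^ 2) hK
    simp only [mul_pow, hv, hs3] at this
    linear_combination this
  rw [div_eq_div_iff (by norm_num) (by positivity)]
  apply mul_left_cancel₀ hr.ne'
  linear_combination (T / 192) * hK2 + (9 * G ^ 6 / 192) * hpow - 2 * G ^ 6 * hs3

end GammaEvaluation

/-! ### The complementary integral as the density of a product of two sines. -/

section ComplementaryIntegral

open MeasureTheory

lemma image_mul_sin_Ioo {w : ℝ} (hw : 0 < w) :
    (fun φ => w * Real.sin φ) '' Set.Ioo 0 (Real.pi / 2) = Set.Ioo 0 w := by
  ext u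
  simp only [Set.mem_image, Set.mem_Ioo]
  constructor
  · rintro ⟨φ, ⟨h0, h1⟩, rfl⟩
    have hs : 0 < Real.sin φ := Real.sin_pos_of_pos_of_lt_pi h0 (by linarith)
    have hs1 : Real.sin φ < 1 := by
      rw [← Real.sin_pi_div_two]
      exact Real.sin_lt_sin_of_lt_of_le_pi_div_two (by linarith) le_rfl h1
    exact ⟨by positivity, by nlinarith⟩
  · rintro ⟨h0, h1⟩
    have hlt : u / w < 1 := (div_lt_one hw).2 h1
    have hpos : 0 < u / w := by positivity
    refine ⟨Real.arcsin (u / w), ⟨Real.arcsin_pos.2 hpos, Real.arcsin_lt_pi_div_two.2 hlt⟩, ?_⟩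
    rw [Real.sin_arcsin (by linarith) hlt.le]
    field_simp

/-- Working with `ENNReal`-valued integrals spares all integrability conditions in the later
exchange of integrals. -/
lemma lintegral_comp_mul_sin {w : ℝ} (hw : 0 < w) (G : ℝ → ENNReal) :
    ∫⁻ φ in Set.Ioo 0 (Real.pi / 2), G (w * Real.sin φ) =
      ∫⁻ u in Set.Ioo 0 w, ENNReal.ofReal (1 / Real.sqrt (w ^ 2 - u ^ 2)) * G u := by
  rw [← image_mul_sin_Ioo hw, lintegral_image_eq_lintegral_abs_deriv_mul measurableSet_Ioo
    (fun φ _ => ((Real.hasDerivAt_sin φ).const_mul w).hasDerivWithinAt)]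
  · refine setLIntegral_congr_fun measurableSet_Ioo fun φ hφ => ?_
    have hc : 0 < Real.cos φ := Real.cos_pos_of_mem_Ioo ⟨by linarith [hφ.1, Real.pi_pos], hφ.2⟩
    have e : w ^ 2 - (w * Real.sin φ) ^ 2 = (w * Real.cos φ) ^ 2 := by
      linear_combination -w ^ 2 * Real.sin_sq_add_cos_sq φ
    have hwc : 0 < w * Real.cos φ := by positivity
    rw [← mul_assoc, ← ENNReal.ofReal_mul (abs_nonneg _), e, Real.sqrt_sq hwc.le, abs_of_pos hwc,
      mul_one_div_cancel hwc.ne', ENNReal.ofReal_one, one_mul]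
  · intro φ hφ ψ hψ h
    have hl := Real.pi_pos
    exact Real.injOn_sin ⟨by linarith [hφ.1], hφ.2.le⟩ ⟨by linarith [hψ.1], hψ.2.le⟩
      (mul_left_cancel₀ hw.ne' h)

/-- The substitution for `K(√(1-u²)) = ∫_u^1 dw / √((1-w²)(w²-u²))`; it decreases from `1` to `u`.
-/
lemma image_sqrt_one_sub_mul_sin_sq {u : ℝ} (h0 : 0 < u) (h1 : u < 1) :
    (fun θ => Real.sqrt (1 - (1 - u ^ 2) * Real.sin θ ^ 2)) '' Set.Ioo 0 (Real.pi / 2) =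
      Set.Ioo u 1 := by
  have hu : 0 < 1 - u ^ 2 := by nlinarith
  ext w
  simp only [Set.mem_image, Set.mem_Ioo]
  constructor
  · rintro ⟨θ, ⟨ha, hb⟩, rfl⟩
    have hs : 0 < Real.sin θ := Real.sin_pos_of_pos_of_lt_pi ha (by linarith)
    have hs1 : Real.sin θ < 1 := by
      rw [← Real.sin_pi_div_two]
      exact Real.sin_lt_sin_of_lt_of_le_pi_div_two (by linarith) le_rfl hb
    have hs2 : Real.sin θ ^ 2 < 1 := by nlinarith
    constructor
    · rw [Real.lt_sqrt h0.le]; nlinarith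
    · rw [Real.sqrt_lt' one_pos]; nlinarith [mul_pos hu (pow_pos hs 2)]
  · rintro ⟨ha, hb⟩
    have hw0 : 0 < w := h0.trans ha
    have hw : 0 < 1 - w ^ 2 := by nlinarith
    have hlt : Real.sqrt ((1 - w ^ 2) / (1 - u ^ 2)) < 1 := by
      rw [Real.sqrt_lt' one_pos, one_pow, div_lt_one hu]; nlinarith
    have hpos : 0 < Real.sqrt ((1 - w ^ 2) / (1 - u ^ 2)) := by positivity
    refine ⟨Real.arcsin (Real.sqrt ((1 - w ^ 2) / (1 - u ^ 2))),
      ⟨Real.arcsin_pos.2 hpos, Real.arcsin_lt_pi_div_two.2 hlt⟩, ?_⟩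
    rw [Real.sin_arcsin (by linarith) hlt.le, Real.sq_sqrt (by positivity),
      mul_div_cancel₀ _ hu.ne', sub_sub_cancel, Real.sqrt_sq hw0.le]

/-- The complementary elliptic integral as an integral over `u < w < 1`. -/
lemma ofReal_ellipticK_complementary {u : ℝ} (h0 : 0 < u) (h1 : u < 1) :
    ENNReal.ofReal (ellipticK (Real.sqrt (1 - u ^ 2))) =
      ∫⁻ w in Set.Ioo u 1, ENNReal.ofReal (1 / Real.sqrt (1 - w ^ 2)) *
        ENNReal.ofReal (1 / Real.sqrt (w ^ 2 - u ^ 2)) := by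
  have hu : 0 < 1 - u ^ 2 := by nlinarith
  have hsq : Real.sqrt (1 - u ^ 2) ^ 2 = 1 - u ^ 2 := Real.sq_sqrt hu.le
  have hk : Real.sqrt (1 - u ^ 2) ^ 2 < 1 := by rw [hsq]; nlinarith
  have hc := continuous_ellipticK_integrand hk
  have hpos : ∀ θ : ℝ, 0 < 1 - (1 - u ^ 2) * Real.sin θ ^ 2 := fun θ => by
    nlinarith [Real.sin_sq_le_one θ, sq_nonneg (Real.sin θ)]
  rw [ellipticK, intervalIntegral.integral_of_le (by positivity), integral_Ioc_eq_integral_Ioo,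
    ofReal_integral_eq_lintegral_ofReal
      ((hc.integrableOn_Icc (a := 0) (b := Real.pi / 2)).mono_set Set.Ioo_subset_Icc_self)
      (Filter.Eventually.of_forall fun θ => by positivity),
    ← image_sqrt_one_sub_mul_sin_sq h0 h1,
    lintegral_image_eq_lintegral_abs_deriv_mul measurableSet_Ioo
      (f' := fun θ => -((1 - u ^ 2) * (2 * Real.sin θ * Real.cos θ)) /
        (2 * Real.sqrt (1 - (1 - u ^ 2) * Real.sin θ ^ 2)))
      (fun θ _ => by
        have h := ((((Real.hasDerivAt_sin θ).pow 2).const_mul (1 - u ^ 2)).const_sub 1).sqrt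
          (hpos θ).ne'
        simp only [Nat.cast_ofNat, Nat.add_one_sub_one, pow_one] at h
        exact h.hasDerivWithinAt)]
  · refine setLIntegral_congr_fun measurableSet_Ioo fun θ hθ => ?_
    have hcos : 0 < Real.cos θ := Real.cos_pos_of_mem_Ioo ⟨by linarith [hθ.1, Real.pi_pos], hθ.2⟩
    have hsin : 0 < Real.sin θ :=
      Real.sin_pos_of_pos_of_lt_pi hθ.1 (by linarith [hθ.2, Real.pi_pos])
    have hW := Real.sqrt_pos.2 (hpos θ)
    have hr := Real.sqrt_pos.2 hu
    have e1 : 1 - Real.sqrt (1 - (1 - u ^ 2) * Real.sin θ ^ 2) ^ 2 =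
        (Real.sqrt (1 - u ^ 2) * Real.sin θ) ^ 2 := by
      rw [Real.sq_sqrt (hpos θ).le, mul_pow, hsq]; ring
    have e2 : Real.sqrt (1 - (1 - u ^ 2) * Real.sin θ ^ 2) ^ 2 - u ^ 2 =
        (Real.sqrt (1 - u ^ 2) * Real.cos θ) ^ 2 := by
      rw [Real.sq_sqrt (hpos θ).le, mul_pow, hsq, Real.cos_sq']; ring
    rw [e1, e2, Real.sqrt_sq (by positivity), Real.sqrt_sq (by positivity), neg_div, abs_neg,
      abs_of_pos (by positivity), ← ENNReal.ofReal_mul (by positivity),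
      ← ENNReal.ofReal_mul (by positivity), hsq]
    congr 1
    field_simp
    rw [hsq]
  · intro θ hθ ψ hψ h
    have hl := Real.pi_pos
    have hs : ∀ x ∈ Set.Ioo 0 (Real.pi / 2), 0 ≤ Real.sin x := fun x hx =>
      (Real.sin_pos_of_pos_of_lt_pi hx.1 (by linarith [hx.2])).le
    have h2 := (Real.sqrt_inj (hpos θ).le (hpos ψ).le).1 h
    have h3 : Real.sin θ ^ 2 = Real.sin ψ ^ 2 := by
      apply mul_left_cancel₀ hu.ne'
      linarith
    exact Real.injOn_sin ⟨by linarith [hθ.1], hθ.2.le⟩ ⟨by linarith [hψ.1], hψ.2.le⟩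
      ((pow_left_inj₀ (hs θ hθ) (hs ψ hψ) two_ne_zero).1 h3)

/-- Integration against the complementary elliptic integral is averaging over products
of two sines. -/
theorem lintegral_ellipticK_complementary_mul {G : ℝ → ENNReal} (hG : Measurable G) :
    ∫⁻ u in Set.Ioo (0 : ℝ) 1, ENNReal.ofReal (ellipticK (Real.sqrt (1 - u ^ 2))) * G u =
      ∫⁻ γ in Set.Ioo 0 (Real.pi / 2), ∫⁻ φ in Set.Ioo 0 (Real.pi / 2),
        G (Real.sin γ * Real.sin φ) := by
  set F : ℝ → ℝ → ENNReal := fun w u => ENNReal.ofReal (1 / Real.sqrt (1 - w ^ 2)) *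
    ENNReal.ofReal (1 / Real.sqrt (w ^ 2 - u ^ 2)) * G u with hF
  have hFm : Measurable (Function.uncurry F) := by
    simp only [hF, Function.uncurry_def]
    fun_prop
  -- The indicator of the triangle `u < w` puts both iterated integrals on the unit square, where
  -- Tonelli applies.
  set S : Set (ℝ × ℝ) := {p | p.2 < p.1} with hS
  have hSm : MeasurableSet S := measurableSet_lt measurable_snd measurable_fst
  have e1 : ∫⁻ γ in Set.Ioo 0 (Real.pi / 2), ∫⁻ φ in Set.Ioo 0 (Real.pi / 2),
        G (Real.sin γ * Real.sin φ) =
      ∫⁻ w in Set.Ioo (0 : ℝ) 1, ∫⁻ u in Set.Ioo (0 : ℝ) 1, S.indicator (Function.uncurry F) (w, u)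
      := by
    have h := lintegral_comp_mul_sin one_pos fun w =>
      ∫⁻ u in Set.Ioo 0 w, ENNReal.ofReal (1 / Real.sqrt (w ^ 2 - u ^ 2)) * G u
    simp only [one_mul, one_pow] at h
    calc _ = ∫⁻ γ in Set.Ioo 0 (Real.pi / 2), ∫⁻ u in Set.Ioo 0 (Real.sin γ),
          ENNReal.ofReal (1 / Real.sqrt (Real.sin γ ^ 2 - u ^ 2)) * G u :=
        setLIntegral_congr_fun measurableSet_Ioo fun γ hγ => lintegral_comp_mul_sin
          (Real.sin_pos_of_pos_of_lt_pi hγ.1 (by linarith [hγ.2, Real.pi_pos])) G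
      _ = _ := h
      _ = _ := by
        refine setLIntegral_congr_fun measurableSet_Ioo fun w hw => ?_
        rw [← lintegral_const_mul' _ _ ENNReal.ofReal_ne_top]
        have : ∀ u, S.indicator (Function.uncurry F) (w, u) =
            (Set.Iio w).indicator (fun u => F w u) u := fun u => by
          simp [Set.indicator, hS]
        simp only [this]
        rw [setLIntegral_indicator measurableSet_Iio, Set.Iio_inter_Ioo, min_eq_left hw.2.le]
        simp only [hF, mul_assoc]
  rw [e1, lintegral_lintegral_swap]
  · refine setLIntegral_congr_fun measurableSet_Ioo fun u hu => ?_
    have : ∀ w, S.indicator (Function.uncurry F) (w, u) =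
        (Set.Ioi u).indicator (fun w => F w u) w := fun w => by
      simp [Set.indicator, hS]
    simp only [this]
    rw [setLIntegral_indicator measurableSet_Ioi, Set.Ioi_inter_Ioo, max_eq_left hu.1.le,
      ofReal_ellipticK_complementary hu.1 hu.2, ← lintegral_mul_const]
    fun_prop
  · exact (hFm.indicator hSm).aemeasurable

/-- The uniform (Lebesgue) measure on the square `(0, π/2)²`. -/
noncomputable def quarterSquare : Measure (ℝ × ℝ) :=
  (volume.restrict (Set.Ioo 0 (Real.pi / 2))).prod (volume.restrict (Set.Ioo 0 (Real.pi / 2)))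

instance : IsFiniteMeasure quarterSquare := by unfold quarterSquare; infer_instance

lemma measurable_ellipticK : Measurable ellipticK := by
  have e : ellipticK = fun k => ∫ θ in Set.Ioc 0 (Real.pi / 2),
      1 / Real.sqrt (1 - k ^ 2 * Real.sin θ ^ 2) := by
    ext k
    rw [ellipticK, intervalIntegral.integral_of_le (by positivity)]
  rw [e]
  apply StronglyMeasurable.measurable
  refine StronglyMeasurable.integral_prod_right'
    (f := fun p : ℝ × ℝ => 1 / Real.sqrt (1 - p.1 ^ 2 * Real.sin p.2 ^ 2)) ?_
  apply Measurable.stronglyMeasurable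
  fun_prop

lemma withDensity_ellipticK_complementary :
    (volume.restrict (Set.Ioo (0 : ℝ) 1)).withDensity
        (fun u => ENNReal.ofReal (ellipticK (Real.sqrt (1 - u ^ 2)))) =
      quarterSquare.map fun p => Real.sin p.1 * Real.sin p.2 := by
  have hm : Measurable fun p : ℝ × ℝ => Real.sin p.1 * Real.sin p.2 := by fun_prop
  have hK : Measurable fun u => ENNReal.ofReal (ellipticK (Real.sqrt (1 - u ^ 2))) :=
    (measurable_ellipticK.comp (by fun_prop)).ennreal_ofReal
  refine Measure.ext_of_lintegral _ fun G hG => ?_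
  rw [lintegral_withDensity_eq_lintegral_mul _ hK hG, lintegral_map hG hm, quarterSquare,
    lintegral_prod (fun p : ℝ × ℝ => G (Real.sin p.1 * Real.sin p.2)) (hG.comp hm).aemeasurable]
  exact lintegral_ellipticK_complementary_mul hG

lemma ellipticK_nonneg (k : ℝ) : 0 ≤ ellipticK k :=
  intervalIntegral.integral_nonneg (by positivity) fun θ _ => by positivity

/-- A bounded function is integrable for the finite image measure, so the logarithmic singularity of
`K` at `u = 0` needs no estimate. -/
theorem integral_ellipticK_complementary_mul {g : ℝ → ℂ} (hg : Measurable g)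
    {C : ℝ} (hC : ∀ u, ‖g u‖ ≤ C) :
    IntegrableOn (fun u => (ellipticK (Real.sqrt (1 - u ^ 2)) : ℂ) * g u) (Set.Ioo 0 1) ∧
    ∫ u in Set.Ioo (0 : ℝ) 1, (ellipticK (Real.sqrt (1 - u ^ 2)) : ℂ) * g u =
      ∫ p, g (Real.sin p.1 * Real.sin p.2) ∂quarterSquare := by
  have hm : Measurable fun p : ℝ × ℝ => Real.sin p.1 * Real.sin p.2 := by fun_prop
  have hK : Measurable fun u => ENNReal.ofReal (ellipticK (Real.sqrt (1 - u ^ 2))) :=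
    (measurable_ellipticK.comp (by fun_prop)).ennreal_ofReal
  have hi : Integrable g (quarterSquare.map fun p => Real.sin p.1 * Real.sin p.2) :=
    Integrable.of_bound hg.aestronglyMeasurable C (Filter.Eventually.of_forall hC)
  have hfin : ∀ᵐ u ∂(volume.restrict (Set.Ioo (0 : ℝ) 1)),
      ENNReal.ofReal (ellipticK (Real.sqrt (1 - u ^ 2))) < ⊤ :=
    Filter.Eventually.of_forall fun u => ENNReal.ofReal_lt_top
  have hs : ∀ u, (ENNReal.ofReal (ellipticK (Real.sqrt (1 - u ^ 2)))).toReal • g u =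
      (ellipticK (Real.sqrt (1 - u ^ 2)) : ℂ) * g u := fun u => by
    rw [ENNReal.toReal_ofReal (ellipticK_nonneg _), Complex.real_smul]
  constructor
  · rw [← withDensity_ellipticK_complementary,
      integrable_withDensity_iff_integrable_smul' hK hfin] at hi
    simpa only [hs, IntegrableOn] using hi
  · rw [← integral_map hm.aemeasurable hg.aestronglyMeasurable,
      ← withDensity_ellipticK_complementary, integral_withDensity_eq_integral_toReal_smul hK hfin]
    simp only [hs]

end ComplementaryIntegral

/-! ### The Legendre generating function in the unit disc and its average. -/

section LegendreGenerating

open MeasureTheory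

/-- A function holomorphic on the unit disc is given there by any power series which represents it
near the origin, and the coefficients satisfy Cauchy's estimate. -/
lemma hasSum_of_hasSum_near_zero {f : ℂ → ℂ} (hf : DifferentiableOn ℂ f (Metric.ball 0 1))
    {d : ℕ → ℂ} {r : ℝ} (hr : 0 < r)
    (h : ∀ t : ℂ, ‖t‖ < r → HasSum (fun n => d n * t ^ n) (f t)) :
    (∀ t : ℂ, ‖t‖ < 1 → HasSum (fun n => d n * t ^ n) (f t)) ∧
    ∀ R C : ℝ, 0 < R → R < 1 → (∀ z : ℂ, ‖z‖ = R → ‖f z‖ ≤ C) → ∀ n, ‖d n‖ ≤ C / R ^ n := by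
  have h1 : HasFPowerSeriesAt f (FormalMultilinearSeries.ofScalars ℂ d) 0 := by
    rw [hasFPowerSeriesAt_iff]
    filter_upwards [Metric.ball_mem_nhds (0 : ℂ) hr] with z hz
    simpa [mul_comm] using h z (by simpa using hz)
  have h2 := (hf.analyticAt (Metric.ball_mem_nhds (0 : ℂ) one_pos)).hasFPowerSeriesAt
  have h3 := (FormalMultilinearSeries.ofScalars_series_eq_iff ℂ _ _).1
    (h1.eq_formalMultilinearSeries h2)
  have h4 : ∀ n, d n = iteratedDeriv n f 0 / (n.factorial : ℂ) := fun n => congrFun h3 n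
  constructor
  · intro t ht
    have := Complex.hasSum_taylorSeries_on_ball hf (z := t) (by simpa using ht)
    convert! this using 2 with n
    rw [h4, sub_zero, smul_eq_mul, smul_eq_mul]
    ring
  · intro R C hR hR1 hC n
    have hd : DiffContOnCl ℂ f (Metric.ball 0 R) := by
      apply DifferentiableOn.diffContOnCl
      rw [closure_ball _ hR.ne']
      exact hf.mono (Metric.closedBall_subset_ball hR1)
    have := Complex.norm_iteratedDeriv_le_of_forall_mem_sphere_norm_le n hR hd
      fun z hz => hC z (by simpa using hz)
    have hn : (0 : ℝ) < n.factorial := by exact_mod_cast n.factorial_pos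
    rw [h4, norm_div, Complex.norm_natCast, div_le_iff₀ hn]
    calc _ ≤ _ := this
      _ = _ := by ring

/-- The roots are `e^{±iθ}` with `w = cos θ`. For `‖t‖ < 1` both factors have positive real part,
which keeps the product off the branch cut. -/
lemma exists_legendre_factorization {w : ℝ} (hw : |w| ≤ 1) :
    ∃ ζ ξ : ℂ, ‖ζ‖ = 1 ∧ ‖ξ‖ = 1 ∧ ∀ t : ℂ, 1 - 2 * t * w + t ^ 2 = (1 - t * ζ) * (1 - t * ξ) := by
  have hw2 : 0 ≤ 1 - w ^ 2 := by
    have := sq_le_one_iff_abs_le_one w |>.2 hw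
    linarith
  have hs := Real.sq_sqrt hw2
  have hs' : ((Real.sqrt (1 - w ^ 2) : ℝ) : ℂ) ^ 2 = 1 - (w : ℂ) ^ 2 := by exact_mod_cast hs
  refine ⟨⟨w, Real.sqrt (1 - w ^ 2)⟩, ⟨w, -Real.sqrt (1 - w ^ 2)⟩, ?_, ?_, fun t => ?_⟩
  · rw [Complex.norm_eq_sqrt_sq_add_sq]; simp [hs]
  · rw [Complex.norm_eq_sqrt_sq_add_sq]; simp [hs]
  · rw [Complex.mk_eq_add_mul_I, Complex.mk_eq_add_mul_I]
    push_cast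
    linear_combination (-t ^ 2) * hs' + t ^ 2 * (Real.sqrt (1 - w ^ 2) : ℂ) ^ 2 * Complex.I_sq

lemma re_one_sub_mul_pos {t ζ : ℂ} (ht : ‖t‖ < 1) (hζ : ‖ζ‖ = 1) : 0 < (1 - t * ζ).re := by
  have h := Complex.re_le_norm (t * ζ)
  rw [norm_mul, hζ, mul_one] at h
  simp only [Complex.sub_re, Complex.one_re]
  linarith

/-- Two arguments in `(-π/2, π/2)` have sum in `(-π, π)`. Algebraically, a real product `zw`
satisfies `Re z · Re(zw) = |z|² Re w > 0`. -/
lemma mul_mem_slitPlane_of_re_pos {z w : ℂ} (hz : 0 < z.re) (hw : 0 < w.re) :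
    z * w ∈ Complex.slitPlane := by
  rw [Complex.mem_slitPlane_iff]
  by_contra! h
  obtain ⟨h1, h2⟩ := h
  rw [Complex.mul_re] at h1
  rw [Complex.mul_im] at h2
  have h3 : z.re * (z.re * w.re - z.im * w.im) = z.re ^ 2 * w.re + z.im ^ 2 * w.re := by
    linear_combination -z.im * h2
  have h4 := mul_nonpos_of_nonneg_of_nonpos hz.le h1
  have h5 : 0 < z.re ^ 2 * w.re := by positivity
  have h6 : 0 ≤ z.im ^ 2 * w.re := by positivity
  linarith

lemma one_sub_two_mul_add_sq_mem_slitPlane {w : ℝ} (hw : |w| ≤ 1) {t : ℂ} (ht : ‖t‖ < 1) :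
    1 - 2 * t * w + t ^ 2 ∈ Complex.slitPlane := by
  obtain ⟨ζ, ξ, h1, h2, h⟩ := exists_legendre_factorization hw
  rw [h]
  exact mul_mem_slitPlane_of_re_pos (re_one_sub_mul_pos ht h1) (re_one_sub_mul_pos ht h2)

lemma norm_one_sub_two_mul_add_sq_ge {w : ℝ} (hw : |w| ≤ 1) {t : ℂ} (ht : ‖t‖ < 1) :
    (1 - ‖t‖) ^ 2 ≤ ‖1 - 2 * t * w + t ^ 2‖ := by
  obtain ⟨ζ, ξ, h1, h2, h⟩ := exists_legendre_factorization hw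
  have key : ∀ x : ℂ, ‖x‖ = 1 → 1 - ‖t‖ ≤ ‖1 - t * x‖ := fun x hx => by
    have := norm_sub_norm_le (1 : ℂ) (t * x)
    rwa [norm_one, norm_mul, hx, mul_one] at this
  rw [h, norm_mul, sq]
  exact mul_le_mul (key ζ h1) (key ξ h2) (by linarith) (norm_nonneg _)

/-- The Legendre polynomial `P_N`, read off from the expansion of `(1 - 2tw + t²)^(-1/2)` in powers
of `2tw - t²`. -/
noncomputable def legendreEval (N : ℕ) (w : ℝ) : ℝ :=
  ∑ p ∈ Finset.HasAntidiagonal.antidiagonal N, pochRatio (1 / 2) p.1 * p.1.choose p.2 *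
    (2 * w) ^ (p.1 - p.2) * (-1) ^ p.2

/-- For `‖t‖ < 1/4`, `2‖t‖ + ‖t‖² ≤ 9/16` makes the double expansion absolutely convergent. Only the
germ at `0` matters: holomorphy extends the expansion to the disc. -/
lemma hasSum_legendreEval_of_norm_lt {w : ℝ} (hw : |w| ≤ 1) {t : ℂ} (ht : ‖t‖ < 1 / 4) :
    HasSum (fun N => (legendreEval N w : ℂ) * t ^ N)
      ((1 - 2 * t * w + t ^ 2) ^ (-(1 / 2) : ℂ)) := by
  have hle : ‖2 * t * (w : ℂ)‖ + ‖-t ^ 2‖ ≤ 9 / 16 := by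
    rw [norm_mul, norm_mul, norm_neg, norm_pow, Complex.norm_real, Real.norm_eq_abs]
    have h2 : ‖(2 : ℂ)‖ = 2 := by simp
    rw [h2]
    have h3 := mul_le_mul_of_nonneg_left hw (norm_nonneg t)
    nlinarith [norm_nonneg t]
  have hlt : ‖2 * t * (w : ℂ) + -t ^ 2‖ < 1 := (norm_add_le _ _).trans_lt (by linarith)
  have hsum : Summable fun n => ‖((pochRatio (1 / 2) n : ℝ) : ℂ)‖ *
      (‖2 * t * (w : ℂ)‖ + ‖-t ^ 2‖) ^ n := by
    refine Summable.of_nonneg_of_le (fun n => by positivity) (fun n => ?_)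
      (summable_geometric_of_lt_one (r := 9 / 16) (by norm_num) (by norm_num))
    rw [Complex.norm_real, Real.norm_of_nonneg (pochRatio_nonneg (by norm_num) n)]
    exact (mul_le_of_le_one_left (by positivity)
      (pochRatio_le_one (by norm_num) (by norm_num) n)).trans
      (pow_le_pow_left₀ (by positivity) hle n)
  have h := hasSum_antidiagonal_choose hsum
  rw [(hasSum_one_sub_cpow_neg_half hlt).tsum_eq,
    show 1 - (2 * t * (w : ℂ) + -t ^ 2) = 1 - 2 * t * w + t ^ 2 by ring] at h
  refine h.congr_fun fun N => ?_
  rw [legendreEval]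
  push_cast
  rw [Finset.sum_mul]
  refine Finset.sum_congr rfl fun p hp => ?_
  rw [Finset.HasAntidiagonal.mem_antidiagonal] at hp
  rcases le_or_gt p.2 p.1 with h | h
  · obtain ⟨e, he⟩ := Nat.exists_eq_add_of_le h
    rw [← hp, he, Nat.add_sub_cancel_left, neg_pow]
    ring
  · rw [Nat.choose_eq_zero_of_lt h]; simp

/-- Cauchy's estimate on `‖t‖ = 3/4`, where the quadratic has norm at least `1/16`, gives the
constant `4`. This crude growth bound suffices for domination when `‖t‖ < 3/4`, which includes `t =
-i/2`. -/
lemma hasSum_legendreEval {w : ℝ} (hw : |w| ≤ 1) :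
    (∀ t : ℂ, ‖t‖ < 1 → HasSum (fun N => (legendreEval N w : ℂ) * t ^ N)
      ((1 - 2 * t * w + t ^ 2) ^ (-(1 / 2) : ℂ))) ∧
    ∀ N, |legendreEval N w| ≤ 4 * (4 / 3) ^ N := by
  have hd : DifferentiableOn ℂ (fun t : ℂ => (1 - 2 * t * w + t ^ 2) ^ (-(1 / 2) : ℂ))
      (Metric.ball 0 1) := by
    refine DifferentiableOn.cpow_const (by fun_prop) fun t ht => ?_
    exact one_sub_two_mul_add_sq_mem_slitPlane hw (by simpa using ht)
  obtain ⟨h1, h2⟩ := hasSum_of_hasSum_near_zero hd (r := 1 / 4) (by norm_num)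
    fun t ht => hasSum_legendreEval_of_norm_lt hw ht
  refine ⟨h1, fun N => ?_⟩
  have h3 := h2 (3 / 4) 4 (by norm_num) (by norm_num) (fun z hz => ?_) N
  · rw [Complex.norm_real, Real.norm_eq_abs] at h3
    refine h3.trans_eq ?_
    rw [div_eq_mul_inv, ← inv_pow]
    norm_num
  · have h4 := norm_one_sub_two_mul_add_sq_ge hw (t := z) (by rw [hz]; norm_num)
    have e : (-(1 / 2) : ℂ) = ((-(1 / 2) : ℝ) : ℂ) := by push_cast; ring
    rw [e, Complex.norm_cpow_real]
    rw [hz] at h4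
    calc _ ≤ ((1 - 3 / 4) ^ 2 : ℝ) ^ (-(1 / 2) : ℝ) :=
          Real.rpow_le_rpow_of_nonpos (by norm_num) h4 (by norm_num)
      _ = 4 := by
          rw [← Real.rpow_natCast, ← Real.rpow_mul (by norm_num)]
          norm_num [Real.rpow_neg_one]

lemma legendreEval_neg (N : ℕ) (w : ℝ) : legendreEval N (-w) = (-1) ^ N * legendreEval N w := by
  rw [legendreEval, legendreEval, Finset.mul_sum]
  refine Finset.sum_congr rfl fun p hp => ?_
  rw [Finset.HasAntidiagonal.mem_antidiagonal] at hp
  rcases le_or_gt p.2 p.1 with h | h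
  · obtain ⟨e, he⟩ := Nat.exists_eq_add_of_le h
    rw [← hp, he, Nat.add_sub_cancel_left, mul_neg, neg_pow (2 * w), add_right_comm, pow_add,
      ← two_mul, pow_mul]
    norm_num
    ring
  · rw [Nat.choose_eq_zero_of_lt h]; simp

lemma legendreEval_two_mul (m : ℕ) (w : ℝ) :
    legendreEval (2 * m) w = ∑ p ∈ Finset.HasAntidiagonal.antidiagonal m,
      pochRatio (1 / 2) (2 * p.1 + p.2) * (2 * p.1 + p.2).choose p.2 * 4 ^ p.1 * (-1) ^ p.2 *
        w ^ (2 * p.1) := by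
  rw [legendreEval]
  symm
  -- The pairs `(a, b)` missed by this reindexing have `a < b`, so their binomial coefficient is
  -- zero.
  refine Finset.sum_of_injOn (fun p => (2 * p.1 + p.2, p.2)) ?_ ?_ ?_ ?_
  · rintro ⟨a, b⟩ _ ⟨c, d⟩ _ h
    simp only [Prod.mk.injEq] at h ⊢
    omega
  · rintro ⟨a, b⟩ h
    simp only [Finset.mem_coe,
      Finset.HasAntidiagonal.mem_antidiagonal] at h ⊢
    omega
  · rintro ⟨a, b⟩ h h'
    rw [Finset.HasAntidiagonal.mem_antidiagonal] at h
    simp only at h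
    have : a < b := by
      by_contra! hab
      apply h'
      refine ⟨(m - b, b), ?_, ?_⟩
      · simp only [Finset.mem_coe, Finset.HasAntidiagonal.mem_antidiagonal]
        omega
      · simp only [Prod.mk.injEq, and_true]
        omega
    rw [Nat.choose_eq_zero_of_lt this]
    simp
  · rintro ⟨a, b⟩ _
    simp only [Nat.add_sub_cancel_right, pow_mul, mul_pow]
    norm_num
    ring

lemma integral_quarterSquare_pow (i : ℕ) :
    ∫ p, (Real.sin p.1 * Real.sin p.2) ^ (2 * i) ∂quarterSquare =
      (Real.pi / 2 * pochRatio (1 / 2) i) ^ 2 := by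
  have h : ∫ θ in Set.Ioo 0 (Real.pi / 2), Real.sin θ ^ (2 * i) =
      Real.pi / 2 * pochRatio (1 / 2) i := by
    rw [← integral_sin_pow_two_mul_zero_pi_div_two, ← integral_Ioc_eq_integral_Ioo,
      intervalIntegral.integral_of_le (by positivity)]
  simp only [quarterSquare, mul_pow (Real.sin _)]
  rw [integral_prod_mul (fun θ => Real.sin θ ^ (2 * i)) (fun θ => Real.sin θ ^ (2 * i)), h, sq]

lemma continuous_legendreEval (N : ℕ) : Continuous (legendreEval N) := by
  unfold legendreEval
  fun_prop

lemma integral_quarterSquare_legendreEval (m : ℕ) :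
    ∫ p, legendreEval (2 * m) (Real.sin p.1 * Real.sin p.2) ∂quarterSquare =
      Real.pi ^ 2 / 4 * ((-1) ^ m * pochRatio (1 / 2) m ^ 3) := by
  simp only [legendreEval_two_mul]
  rw [integral_finsetSum]
  · simp only [integral_const_mul, integral_quarterSquare_pow]
    rw [← sum_antidiagonal_legendre_moment, Finset.mul_sum]
    exact Finset.sum_congr rfl fun p _ => by ring
  · intro p _
    refine Integrable.const_mul ?_ _
    refine Integrable.of_bound (C := 1)
      (Continuous.aestronglyMeasurable (by fun_prop)) (Filter.Eventually.of_forall fun x => ?_)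
    rw [norm_pow, norm_mul]
    refine pow_le_one₀ (by positivity) (mul_le_one₀ ?_ (norm_nonneg _) ?_)
    · exact Real.abs_sin_le_one _
    · exact Real.abs_sin_le_one _

/-- The average of the even part of the Legendre generating function over the square. -/
theorem hasSum_integral_legendre_generating {t : ℂ} (ht : ‖t‖ < 3 / 4) :
    HasSum (fun m : ℕ => ((Real.pi ^ 2 / 2 * pochRatio (1 / 2) m ^ 3 : ℝ) : ℂ) * (-t ^ 2) ^ m)
      (∫ p, ((1 - 2 * t * (Real.sin p.1 * Real.sin p.2 : ℝ) + t ^ 2) ^ (-(1 / 2) : ℂ) +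
        (1 - 2 * t * (-(Real.sin p.1 * Real.sin p.2) : ℝ) + t ^ 2) ^ (-(1 / 2) : ℂ))
          ∂quarterSquare) := by
  have hs : ∀ p : ℝ × ℝ, |Real.sin p.1 * Real.sin p.2| ≤ 1 := fun p => by
    rw [abs_mul]
    exact mul_le_one₀ (Real.abs_sin_le_one _) (abs_nonneg _) (Real.abs_sin_le_one _)
  have hs' : ∀ p : ℝ × ℝ, |-(Real.sin p.1 * Real.sin p.2)| ≤ 1 := fun p => by
    rw [abs_neg]; exact hs p
  have key := hasSum_integral_of_dominated_convergence (μ := quarterSquare)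
    (F := fun N p => ((legendreEval N (Real.sin p.1 * Real.sin p.2) +
      legendreEval N (-(Real.sin p.1 * Real.sin p.2)) : ℝ) : ℂ) * t ^ N)
    (f := fun p => (1 - 2 * t * (Real.sin p.1 * Real.sin p.2 : ℝ) + t ^ 2) ^ (-(1 / 2) : ℂ) +
        (1 - 2 * t * (-(Real.sin p.1 * Real.sin p.2) : ℝ) + t ^ 2) ^ (-(1 / 2) : ℂ))
    (fun N _ => 8 * (4 / 3 * ‖t‖) ^ N)
    (fun N => by
      have := continuous_legendreEval N
      exact Continuous.aestronglyMeasurable (by fun_prop))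
    (fun N => Filter.Eventually.of_forall fun p => by
      rw [norm_mul, Complex.norm_real, norm_pow, mul_pow, ← mul_assoc]
      refine mul_le_mul_of_nonneg_right ?_ (by positivity)
      have h1 := (hasSum_legendreEval (hs p)).2 N
      have h2 := (hasSum_legendreEval (hs' p)).2 N
      exact (abs_add_le _ _).trans (by linarith))
    (Filter.Eventually.of_forall fun p =>
      (summable_geometric_of_lt_one (by positivity) (by linarith)).mul_left 8)
    (integrable_const _)
    (Filter.Eventually.of_forall fun p => by
      have h1 := (hasSum_legendreEval (hs p)).1 t (by linarith)
      have h2 := (hasSum_legendreEval (hs' p)).1 t (by linarith)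
      refine (h1.add h2).congr_fun fun N => ?_
      push_cast
      ring)
  -- By parity the odd-degree terms cancel, so the sum runs over `N = 2m`.
  have hinj : Function.Injective fun m : ℕ => 2 * m := fun a b h => by simpa using h
  rw [← hinj.hasSum_iff] at key
  · refine key.congr_fun fun m => ?_
    simp only [Function.comp_apply]
    rw [integral_mul_const, integral_complex_ofReal]
    have e : ∀ w, legendreEval (2 * m) w + legendreEval (2 * m) (-w) =
        2 * legendreEval (2 * m) w := fun w => by
      rw [legendreEval_neg, pow_mul]; norm_num; ring
    simp only [e, integral_const_mul, integral_quarterSquare_legendreEval]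
    rw [pow_mul, neg_pow]
    push_cast
    ring
  · intro N hN
    have hodd : Odd N := by
      rw [← Nat.not_even_iff_odd]
      rintro ⟨k, hk⟩
      exact hN ⟨k, by simp only []; omega⟩
    have e : ∀ w, legendreEval N w + legendreEval N (-w) = 0 := fun w => by
      rw [legendreEval_neg, hodd.neg_one_pow]; ring
    simp [e]

end LegendreGenerating


/-! ### Specialisation to `t = -i/2` and assembly. -/

open MeasureTheory

/-- The positive real factor `4` passes through the principal root without changing its branch. -/
lemma one_div_sqrt_three_add_eq (u : ℝ) :
    1 / Complex.sqrt (3 + 4 * Complex.I * u) =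
      1 / 2 * (1 - 2 * (-Complex.I / 2) * u + (-Complex.I / 2) ^ 2) ^ (-(1 / 2) : ℂ) := by
  have e : (3 + 4 * Complex.I * u : ℂ) = ((4 : ℝ) : ℂ) *
      (1 - 2 * (-Complex.I / 2) * u + (-Complex.I / 2) ^ 2) := by
    push_cast
    linear_combination (-1 : ℂ) * Complex.I_sq
  have h2 : ((4 : ℝ) : ℂ) ^ (2⁻¹ : ℂ) = 2 := by
    have : (2⁻¹ : ℂ) = ((2⁻¹ : ℝ) : ℂ) := by push_cast; ring
    rw [this, ← Complex.ofReal_cpow (by norm_num), ← one_div, ← Real.sqrt_eq_rpow,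
      show (4 : ℝ) = 2 ^ 2 by norm_num, Real.sqrt_sq (by norm_num)]
    norm_num
  have h0 : (1 - 2 * (-Complex.I / 2) * u + (-Complex.I / 2) ^ 2 : ℂ) ≠ 0 := by
    intro h
    have := congrArg Complex.re h
    simp [sq] at this
    norm_num at this
  have h4 : ∀ z : ℂ, z ≠ 0 → (((4 : ℝ) : ℂ) * z) ^ (2⁻¹ : ℂ) = 2 * z ^ (2⁻¹ : ℂ) := fun z hz => by
    nth_rw 2 [← h2]
    rw [Complex.cpow_def_of_ne_zero (mul_ne_zero (by norm_num) hz),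
      Complex.cpow_def_of_ne_zero (by norm_num), Complex.cpow_def_of_ne_zero hz,
      Complex.log_ofReal_mul (by norm_num) hz, ← Complex.exp_add, add_mul,
      Complex.ofReal_log (by norm_num)]
  rw [Complex.sqrt, e, h4 _ h0, Complex.cpow_neg, one_div (2 : ℂ), one_div, mul_inv]

lemma one_le_norm_sqrt_three_add (u : ℝ) : 1 ≤ ‖Complex.sqrt (3 + 4 * Complex.I * u)‖ := by
  have e : (2⁻¹ : ℂ) = ((2⁻¹ : ℝ) : ℂ) := by push_cast; ring
  rw [Complex.sqrt, e, Complex.norm_cpow_real]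
  refine Real.one_le_rpow ?_ (by norm_num)
  have h := Complex.re_le_norm (3 + 4 * Complex.I * u)
  simp at h
  linarith

lemma two_mul_sqrt_mul_one_sub (x : ℝ) :
    2 * Real.sqrt (x * (1 - x)) = Real.sqrt (1 - (1 - 2 * x) ^ 2) := by
  rw [show 1 - (1 - 2 * x) ^ 2 = 2 ^ 2 * (x * (1 - x)) by ring,
    Real.sqrt_mul (sq_nonneg 2), Real.sqrt_sq (by norm_num)]

theorem mainTheorem7 :
    IntervalIntegrable
      (fun x : ℝ => (ellipticK (2 * Real.sqrt (x * (1 - x))) : ℂ) /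
        Complex.sqrt (3 + 4 * Complex.I * (1 - 2 * (x : ℂ))))
      MeasureTheory.volume 0 1 ∧
    ∫ x in (0 : ℝ)..1, (ellipticK (2 * Real.sqrt (x * (1 - x))) : ℂ) /
        Complex.sqrt (3 + 4 * Complex.I * (1 - 2 * (x : ℂ))) =
      ((Real.sqrt 3 * Real.Gamma (1 / 3) ^ 6 /
        ((2 : ℝ) ^ (17 / 3 : ℝ) * Real.pi ^ 2) : ℝ) : ℂ) := by
  set g : ℝ → ℂ := fun u => 1 / Complex.sqrt (3 + 4 * Complex.I * u) with hg
  set h : ℝ → ℂ := fun u => (ellipticK (Real.sqrt (1 - u ^ 2)) : ℂ) * g u with hh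
  have hgm : Measurable g := by
    simp only [hg, Complex.sqrt]
    fun_prop
  have hgb : ∀ u, ‖g u‖ ≤ 1 := fun u => by
    rw [hg, norm_div, norm_one]
    exact div_le_one_of_le₀ (one_le_norm_sqrt_three_add u) (norm_nonneg _)
  obtain ⟨hi, hI⟩ := integral_ellipticK_complementary_mul hgm hgb
  obtain ⟨hi', hI'⟩ := integral_ellipticK_complementary_mul (hgm.comp measurable_neg)
    fun u => hgb (-u)
  have hneg : ∀ u, (ellipticK (Real.sqrt (1 - u ^ 2)) : ℂ) * (g ∘ Neg.neg) u = h (-u) := fun u => by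
    simp [hh]
  simp only [hneg] at hi' hI'
  -- Passing to the open interval discards `u = 0` (that is, `x = 1/2`), where `K` diverges and the
  -- Lean integral takes the default value `0`.
  have j1 : IntervalIntegrable h volume 0 1 := by
    rwa [intervalIntegrable_iff_integrableOn_Ioo_of_le zero_le_one]
  have j2 : IntervalIntegrable (fun u => h (-u)) volume 0 1 := by
    rwa [intervalIntegrable_iff_integrableOn_Ioo_of_le zero_le_one]
  have j3 : IntervalIntegrable h volume (-1) 0 := by
    rw [IntervalIntegrable.iff_comp_neg]
    simpa using j2.symm
  have hF : (fun x : ℝ => (ellipticK (2 * Real.sqrt (x * (1 - x))) : ℂ) /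
        Complex.sqrt (3 + 4 * Complex.I * (1 - 2 * (x : ℂ)))) = fun x => h (1 - 2 * x) := by
    ext x
    simp only [hh, hg, two_mul_sqrt_mul_one_sub]
    push_cast
    rw [mul_one_div]
  rw [hF]
  constructor
  · have j4 := ((j3.trans j1).comp_sub_left 1).comp_mul_left (c := 2)
    norm_num at j4
    exact j4.symm
  rw [intervalIntegral.integral_comp_sub_mul h two_ne_zero 1,
    show (1 : ℝ) - 2 * 1 = -1 by norm_num, show (1 : ℝ) - 2 * 0 = 1 by norm_num,
    ← intervalIntegral.integral_add_adjacent_intervals j3 j1]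
  have i1 : ∫ u in (-1 : ℝ)..0, h u = ∫ p, g (-(Real.sin p.1 * Real.sin p.2)) ∂quarterSquare := by
    have := intervalIntegral.integral_comp_neg (a := 0) (b := 1) h
    rw [neg_zero] at this
    rw [← this, intervalIntegral.integral_of_le zero_le_one, integral_Ioc_eq_integral_Ioo, hI']
    rfl
  have i2 : ∫ u in (0 : ℝ)..1, h u = ∫ p, g (Real.sin p.1 * Real.sin p.2) ∂quarterSquare := by
    rw [intervalIntegral.integral_of_le zero_le_one, integral_Ioc_eq_integral_Ioo, hI]
  have int1 : Integrable (fun p : ℝ × ℝ => g (Real.sin p.1 * Real.sin p.2)) quarterSquare :=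
    Integrable.of_bound (hgm.comp (by fun_prop)).aestronglyMeasurable 1
      (Filter.Eventually.of_forall fun p => hgb _)
  have int2 : Integrable (fun p : ℝ × ℝ => g (-(Real.sin p.1 * Real.sin p.2))) quarterSquare :=
    Integrable.of_bound (hgm.comp (by fun_prop)).aestronglyMeasurable 1
      (Filter.Eventually.of_forall fun p => hgb _)
  have key := hasSum_integral_legendre_generating (t := -Complex.I / 2) (by norm_num)
  have ht : -(-Complex.I / 2) ^ 2 = ((1 / 4 : ℝ) : ℂ) := by
    push_cast
    linear_combination (-1 / 4 : ℂ) * Complex.I_sq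
  have hr : (fun m : ℕ => ((Real.pi ^ 2 / 2 * pochRatio (1 / 2) m ^ 3 : ℝ) : ℂ) *
      (-(-Complex.I / 2) ^ 2) ^ m) = fun m : ℕ =>
      ((Real.pi ^ 2 / 2 * (pochRatio (1 / 2) m ^ 3 * (1 / 4) ^ m) : ℝ) : ℂ) := by
    ext m
    rw [ht]
    push_cast
    ring
  rw [hr] at key
  have hval := key.tsum_eq
  rw [← Complex.ofReal_tsum, tsum_mul_left, tsum_pochRatio_half_cube] at hval
  have hgg : ∀ p : ℝ × ℝ, g (-(Real.sin p.1 * Real.sin p.2)) + g (Real.sin p.1 * Real.sin p.2) =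
      1 / 2 * ((1 - 2 * (-Complex.I / 2) * (Real.sin p.1 * Real.sin p.2 : ℝ) +
          (-Complex.I / 2) ^ 2) ^ (-(1 / 2) : ℂ) +
        (1 - 2 * (-Complex.I / 2) * (-(Real.sin p.1 * Real.sin p.2) : ℝ) +
          (-Complex.I / 2) ^ 2) ^ (-(1 / 2) : ℂ)) := fun p => by
    simp only [hg, one_div_sqrt_three_add_eq]
    ring
  rw [i1, i2, ← integral_add int2 int1]
  simp only [hgg]
  -- Constants: `1/2` from `u = 1 - 2x`, `1/2` from the root of `4`, and `(π²/2)(2K/π)² = 2K²`, with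
  -- product `K²/2`.
  rw [integral_const_mul, ← hval, ← ellipticK_singularModulusThree_sq_div_two]
  have hπ := Real.pi_ne_zero
  rw [Complex.real_smul]
  push_cast
  have hπ' : (Real.pi : ℂ) ≠ 0 := by exact_mod_cast hπ
  field_simp
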